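/- Let $\mathsf H$ be a real Hilbert space, $\mathsf V\subset\mathsf H$ a closed vector subspace with orthogonal projector $P_{\mathsf V}$ and normal cone operator $N_{\mathsf V}$, and $m\ge 1$ an integer. Let $\mathsf A\colon\mathsf H\to 2^{\mathsf H}$ be maximally monotone, $\mathsf M\colon\mathsf H\to\mathsf H$ monotone and $\mu$-Lipschitzian with $\mu\in\,]0,+\infty[$, and $\mathsf C\colon\mathsf H\to\mathsf H$ $\zeta$-cocoercive with $\zeta\in\,]0,+\infty[$, i.e. $\langle x-y\mid \mathsf Cx-\mathsf Cy\rangle\ge\zeta\|\mathsf Cx-\mathsf Cy\|^2$ for all $x,y\in\mathsf H$. For every $i\in\{1,\dots,m\}$ let $\mathsf G_i$ be a real Hilbert space, $\mathsf B_i\colon\mathsf G_i\to2^{\mathsf G_i}$ maximally monotone, $\mathsf N_i\colon\mathsf G_i\to2^{\mathsf G_i}$ monotone and such that $\mathsf N_i^{-1}$ is single-valued, everywhere defined and $\nu_i$-Lipschitzian on $\mathsf G_i$ with $\nu_i\in\,]0,+\infty[$, $\mathsf D_i\colon\mathsf G_i\to2^{\mathsf G_i}$ maximally monotone and $\delta_i$-strongly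 monotone with $\delta_i\in\,]0,+\infty[$, and $\mathsf L_i\colon\mathsf H\to\mathsf G_i$ a nonzero bounded linear operator. Let $\boldsymbol Z$ be the set of all $(\overline{\mathsf x},\overline{\mathsf u}_1,\dots,\overline{\mathsf u}_m)\in\mathsf H\times\mathsf G_1\times\cdots\times\mathsf G_m$ such that $$0\in\mathsf A\overline{\mathsf x}+\mathsf M\overline{\mathsf x}+\mathsf C\overline{\mathsf x}+\sum_{i=1}^m\mathsf L_i^*\overline{\mathsf u}_i+N_{\mathsf V}\overline{\mathsf x}\quad\text{and}\quad 0\in\big(\mathsf B_i^{-1}+\mathsf N_i^{-1}+\mathsf D_i^{-1}\big)\overline{\mathsf u}_i-\mathsf L_i\overline{\mathsf x}\quad(1\le i\le m),$$ and suppose that $\boldsymbol Z\neq\varnothing$. Set $$L=\max\{\mu,\nu_1,\dots,\nu_m\}+\sqrt{\sum_{i=1}^m\|\mathsf L_i\|^2},\qquad \beta=\min\{\zeta,\delta_1,\dots,\delta_m\},\qquad \chi=\frac{4\beta}{1+\sqrt{1+16\beta^2L^2}}.$$ Let $\mathsf x_0\in\mathsf V$, $\mathsf y_0\in\mathsf V^\perp$,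 $\mathsf u_{i,0}\in\mathsf G_i$ $(1\le i\le m)$ and $\gamma\in\,]0,\chi[$, write $J_{T}=(\mathrm{Id}+T)^{-1}$ for the resolvent of an operator $T$, and consider the routine: for $n=0,1,2,\dots$ $$\begin{aligned} &\mathsf p_n=J_{\gamma\mathsf A}\Big(\mathsf x_n+\gamma\mathsf y_n-\gamma P_{\mathsf V}\Big((\mathsf M+\mathsf C)\mathsf x_n+\sum_{i=1}^m\mathsf L_i^*\mathsf u_{i,n}\Big)\Big),\qquad \mathsf q_n=P_{\mathsf V}\mathsf p_n,\\ &\text{for } i=1,\dots,m:\\ &\qquad \mathsf r_{i,n}=J_{\gamma\mathsf B_i^{-1}}\big(\mathsf u_{i,n}-\gamma\big((\mathsf N_i^{-1}+\mathsf D_i^{-1})\mathsf u_{i,n}-\mathsf L_i\mathsf x_n\big)\big),\\ &\qquad \mathsf u_{i,n+1}=\mathsf r_{i,n}-\gamma\big(\mathsf N_i^{-1}\mathsf r_{i,n}-\mathsf N_i^{-1}\mathsf u_{i,n}-\mathsf L_i(\mathsf q_n-\mathsf x_n)\big),\\ &\mathsf x_{n+1}=\mathsf q_n-\gamma P_{\mathsf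 V}\Big(\mathsf M\mathsf q_n-\mathsf M\mathsf x_n+\sum_{i=1}^m\mathsf L_i^*(\mathsf r_{i,n}-\mathsf u_{i,n})\Big),\\ &\mathsf y_{n+1}=\mathsf y_n-\frac{\mathsf p_n-\mathsf q_n}{\gamma}. \end{aligned}$$ Then the routine is well defined (it generates exactly one family of sequences), $(\mathsf x_n)_{n\in\mathbb N}$ is a sequence in $\mathsf V$, and there exists $(\overline{\mathsf x},\overline{\mathsf u}_1,\dots,\overline{\mathsf u}_m)\in\boldsymbol Z$ such that $\mathsf x_n\rightharpoonup\overline{\mathsf x}$ and, for every $i\in\{1,\dots,m\}$, $\mathsf u_{i,n}\rightharpoonup\overline{\mathsf u}_i$, where $\rightharpoonup$ denotes weak convergence. -/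

import Mathlib

open Filter Topology
open scoped NNReal Pointwise InnerProductSpace

namespace SetValued

section Operators

variable {E : Type*} [NormedAddCommGroup E] [InnerProductSpace ℝ E]

/-- The inverse of a set-valued operator: `x ∈ A⁻¹ u` if and only if `u ∈ A x`. -/
def inv (A : E → Set E) : E → Set E :=
  fun u => {x | u ∈ A x}

/-- The resolvent `(Id + A)⁻¹` of a set-valued operator, as a set-valued operator. -/
def setResolvent (A : E → Set E) : E → Set E :=
  inv (fun x => {x} + A x)

/-- Monotone set-valued operators. -/
def IsMonotone (A : E → Set E) : Prop :=
  ∀ x, ∀ u ∈ A x, ∀ y, ∀ v ∈ A y, 0 ≤ ⟪x - y, u - v⟫_ℝ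

/-- Maximally monotone operators: `(x, u)` belongs to the graph if and only if it is monotonically
related to every point of the graph. -/
def IsMaximallyMonotone (A : E → Set E) : Prop :=
  ∀ x u, u ∈ A x ↔ ∀ y, ∀ v ∈ A y, 0 ≤ ⟪x - y, u - v⟫_ℝ

/-- `δ`-strongly monotone set-valued operators. -/
def IsStronglyMonotone (δ : ℝ) (A : E → Set E) : Prop :=
  ∀ x, ∀ u ∈ A x, ∀ y, ∀ v ∈ A y, δ * ‖x - y‖ ^ 2 ≤ ⟪x - y, u - v⟫_ℝ

/-- A set-valued operator is `ν`-Lipschitzian if it is single-valued, defined everywhere, and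
`ν`-Lipschitz as a function. -/
def IsLipschitzian (ν : ℝ≥0) (A : E → Set E) : Prop :=
  ∃ T : E → E, (∀ x, A x = {T x}) ∧ LipschitzWith ν T

/-- `ζ`-cocoercive (single-valued) operators. -/
def IsCocoercive (ζ : ℝ) (C : E → E) : Prop :=
  ∀ x y, ζ * ‖C x - C y‖ ^ 2 ≤ ⟪x - y, C x - C y⟫_ℝ

/-- The normal cone operator of a set `S`; it is empty-valued outside of `S`. -/
def normalCone (S : Set E) : E → Set E :=
  fun x => {u | x ∈ S ∧ ∀ y ∈ S, ⟪y - x, u⟫_ℝ ≤ 0}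

end Operators

end SetValued

/-- Weak convergence of a sequence in a real Hilbert space. -/
def WeaklyConverges {E : Type*} [NormedAddCommGroup E] [InnerProductSpace ℝ E]
    (x : ℕ → E) (a : E) : Prop :=
  Tendsto (fun n => toWeakSpace ℝ E (x n)) atTop (𝓝 (toWeakSpace ℝ E a))

namespace PrimalDual

open SetValued

section

variable {H : Type*} [NormedAddCommGroup H] [InnerProductSpace ℝ H] [CompleteSpace H]
  {m : ℕ} {G : Fin m → Type*} [∀ i, NormedAddCommGroup (G i)]
  [∀ i, InnerProductSpace ℝ (G i)] [∀ i, CompleteSpace (G i)]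

/-- The set of solutions `(x, u₁, …, uₘ)` of the composite primal-dual inclusion. -/
def solutionSet (V : ClosedSubmodule ℝ H) (A : H → Set H) (M C : H → H)
    (B N D : ∀ i, G i → Set (G i)) (L : ∀ i, H →L[ℝ] G i) : Set (H × (∀ i, G i)) :=
  {z | (0 : H) ∈ A z.1 + {M z.1} + {C z.1} + {∑ i, (L i).adjoint (z.2 i)}
        + normalCone (V : Set H) z.1 ∧
      ∀ i, (0 : G i) ∈ (inv (B i) (z.2 i) + inv (N i) (z.2 i) + inv (D i) (z.2 i)) - {L i z.1}}

/-- The constant `χ = 4β / (1 + √(1 + 16 β² L²))`. -/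
noncomputable def chi (β L : ℝ) : ℝ :=
  4 * β / (1 + √(1 + 16 * β ^ 2 * L ^ 2))

/-- The sequences occurring in the primal-dual routine. -/
structure Iterates (H : Type*) {m : ℕ} (G : Fin m → Type*) where
  x : ℕ → H
  y : ℕ → H
  p : ℕ → H
  q : ℕ → H
  r : ℕ → ∀ i, G i
  u : ℕ → ∀ i, G i

/-- The sequences `s` are generated by the primal-dual routine with step size `γ`, started at
`x₀`, `y₀`, `(u₁,₀, …, uₘ,₀)`. Values of resolvents and inverses of set-valued operators are
expressed through membership. -/
structure IsRun (V : ClosedSubmodule ℝ H) (A : H → Set H) (M C : H → H)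
    (B N D : ∀ i, G i → Set (G i)) (L : ∀ i, H →L[ℝ] G i) (γ : ℝ)
    (x₀ y₀ : H) (u₀ : ∀ i, G i) (s : Iterates H G) : Prop where
  x_zero : s.x 0 = x₀
  y_zero : s.y 0 = y₀
  u_zero : s.u 0 = u₀
  p_mem : ∀ n, s.p n ∈ setResolvent (γ • A)
    (s.x n + γ • s.y n - γ • V.toSubmodule.starProjection
      (M (s.x n) + C (s.x n) + ∑ i, (L i).adjoint (s.u n i)))
  q_eq : ∀ n, s.q n = V.toSubmodule.starProjection (s.p n)
  r_mem : ∀ n i, ∃ w ∈ inv (N i) (s.u n i) + inv (D i) (s.u n i),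
    s.r n i ∈ setResolvent (γ • inv (B i)) (s.u n i - γ • (w - L i (s.x n)))
  u_succ : ∀ n i, ∃ a ∈ inv (N i) (s.r n i), ∃ b ∈ inv (N i) (s.u n i),
    s.u (n + 1) i = s.r n i - γ • (a - b - L i (s.q n - s.x n))
  x_succ : ∀ n, s.x (n + 1) = s.q n - γ • V.toSubmodule.starProjection
    (M (s.q n) - M (s.x n) + ∑ i, (L i).adjoint (s.r n i - s.u n i))
  y_succ : ∀ n, s.y (n + 1) = s.y n - γ⁻¹ • (s.p n - s.q n)

end

end PrimalDual

/-! The routine is a forward-backward-half-forward iteration with unit step in the Hilbert sum of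
`H` and the `G i`, written in coordinates. The state is `(x n + γ y n, u n)`, which packs `x n ∈ V`
and `y n ∈ Vᗮ` into one vector of `H`. The set-valued part (`resolventPart`) combines the Spingarn
partial inverse of `γ • A` with respect to `V`, which absorbs the normal cone of `V`, with the
operators `γ • inv (B i)`. The Lipschitzian part contains `M`, the inverses of the `N i` and the
skew coupling through the `L i`; its constant is `γ * ℓ`. The remaining part contains `C` and the
inverses of the `D i`, and is `β / γ`-cocoercive. Zeros of the sum project onto solutions, and `γ <
χ` says exactly that the step condition `(γ ℓ)² + γ / (2 β) < 1` holds.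

Under that condition the iteration is Fejér monotone with respect to the zeros, and the gap between
the state and the resolvent output tends to zero (`norm_sq_add_le_of_forwardBackwardHalfForward`).
The sum is maximally monotone (`IsMaximallyMonotone.add_lipschitz`), so its graph is closed for weak
limits of points and strong limits of values. Weak cluster points are therefore zeros, and Opial's
lemma gives weak convergence. Applying the projector onto `V` to the first component recovers the
limit of `x n`.

Existence of resolvents is Minty's theorem, obtained by minimizing the Fitzpatrick function plus
half the squared norm. -/

/-! ### Quadratically regularized minimization over an epigraph. -/

/-- On a closed convex subset of `E × ℝ`, the strongly convex function `(z, t) ↦ t + ‖z‖² / 2`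
attains its infimum as soon as it is bounded below. -/
theorem exists_forall_add_norm_sq_le {E : Type*} [NormedAddCommGroup E] [InnerProductSpace ℝ E]
    [CompleteSpace E] {S : Set (E × ℝ)} (hc : IsClosed S) (hconv : Convex ℝ S)
    (hne : S.Nonempty) (hb : ∀ p ∈ S, 0 ≤ p.2 + ‖p.1‖ ^ 2 / 2) :
    ∃ w ∈ S, ∀ p ∈ S, w.2 + ‖w.1‖ ^ 2 / 2 ≤ p.2 + ‖p.1‖ ^ 2 / 2 := by
  set φ : E × ℝ → ℝ := fun p => p.2 + ‖p.1‖ ^ 2 / 2 with hφ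
  set l := sInf (φ '' S) with hl
  have hbdd : BddBelow (φ '' S) := ⟨0, by rintro _ ⟨p, hp, rfl⟩; exact hb p hp⟩
  have hlow : ∀ p ∈ S, l ≤ φ p := fun p hp => csInf_le hbdd ⟨p, hp, rfl⟩
  have hex : ∀ n : ℕ, ∃ p ∈ S, φ p < l + 1 / ((n : ℝ) + 1) := by
    intro n
    obtain ⟨_, ⟨p, hp, rfl⟩, h⟩ := exists_lt_of_csInf_lt (hne.image φ)
      (show sInf (φ '' S) < l + 1 / ((n : ℝ) + 1) from lt_add_of_pos_right _ (by positivity))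
    exact ⟨p, hp, h⟩
  choose s hs hsl using hex
  -- Comparing the midpoint with the infimum, the parallelogram law bounds distances by the excess
  -- of `φ`; minimizing sequences are thus Cauchy in the first component.
  have hmid : ∀ p ∈ S, ∀ q ∈ S, ‖p.1 - q.1‖ ^ 2 ≤ 4 * (φ p + φ q - 2 * l) := by
    intro p hp q hq
    have h := hlow _ (hconv hp hq (by norm_num : (0 : ℝ) ≤ 1 / 2)
      (by norm_num : (0 : ℝ) ≤ 1 / 2) (by norm_num))
    have h2 := parallelogram_law_with_norm ℝ p.1 q.1
    have h3 : ‖(1 / 2 : ℝ) • p.1 + (1 / 2 : ℝ) • q.1‖ ^ 2 = ‖p.1 + q.1‖ ^ 2 / 4 := by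
      rw [← smul_add, norm_smul, mul_pow]; norm_num; ring
    simp only [hφ, Prod.snd_add, Prod.fst_add, Prod.smul_fst, Prod.smul_snd, smul_eq_mul, h3]
      at h ⊢
    nlinarith
  have hinv : Tendsto (fun n : ℕ => 1 / ((n : ℝ) + 1)) atTop (𝓝 0) :=
    tendsto_one_div_add_atTop_nhds_zero_nat
  have hcau : CauchySeq fun n => (s n).1 := by
    refine cauchySeq_of_le_tendsto_0 (fun n : ℕ => √(8 * (1 / ((n : ℝ) + 1)))) ?_ ?_
    · intro n k N hn hk
      rw [dist_eq_norm]
      refine Real.le_sqrt_of_sq_le ((hmid _ (hs n) _ (hs k)).trans ?_)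
      have h1 := Nat.one_div_le_one_div (α := ℝ) hn
      have h2 := Nat.one_div_le_one_div (α := ℝ) hk
      linarith [hsl n, hsl k]
    · simpa using (hinv.const_mul 8).sqrt
  obtain ⟨z, hz⟩ := cauchySeq_tendsto_of_complete hcau
  have hφlim : Tendsto (fun n => φ (s n)) atTop (𝓝 l) :=
    tendsto_of_tendsto_of_tendsto_of_le_of_le tendsto_const_nhds
      (by simpa using hinv.const_add l) (fun n => hlow _ (hs n)) (fun n => (hsl n).le)
  have ht : Tendsto (fun n => (s n).2) atTop (𝓝 (l - ‖z‖ ^ 2 / 2)) := by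
    refine (hφlim.sub ((hz.norm.pow 2).div_const 2)).congr fun n => ?_
    simp [hφ]
  refine ⟨(z, l - ‖z‖ ^ 2 / 2),
    hc.mem_of_tendsto (hz.prodMk_nhds ht) (Eventually.of_forall hs), fun p hp => ?_⟩
  simpa using hlow p hp

/-- First-order optimality condition for a minimizer of `(z, t) ↦ t + ‖z‖² / 2`. -/
theorem add_inner_le_of_forall_add_norm_sq_le {E : Type*} [NormedAddCommGroup E]
    [InnerProductSpace ℝ E] {S : Set (E × ℝ)} (hconv : Convex ℝ S) {w : E × ℝ} (hw : w ∈ S)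
    (hmin : ∀ p ∈ S, w.2 + ‖w.1‖ ^ 2 / 2 ≤ p.2 + ‖p.1‖ ^ 2 / 2) {p : E × ℝ} (hp : p ∈ S) :
    w.2 + ‖w.1‖ ^ 2 ≤ p.2 + ⟪w.1, p.1⟫_ℝ := by
  -- Minimality is tested on the segment from `w` to `p` and divided by `t`; the quadratic remainder
  -- then vanishes as `t → 0`.
  have key : ∀ t ∈ Set.Ioo (0 : ℝ) 1,
      w.2 + ‖w.1‖ ^ 2 ≤ p.2 + ⟪w.1, p.1⟫_ℝ + t * (‖p.1 - w.1‖ ^ 2 / 2) := by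
    rintro t ⟨ht0, ht1⟩
    have h := hmin _ (hconv hw hp (sub_nonneg.2 ht1.le) ht0.le (by ring))
    have h2 : ‖(1 - t) • w.1 + t • p.1‖ ^ 2
        = ‖w.1‖ ^ 2 + 2 * t * (⟪w.1, p.1⟫_ℝ - ‖w.1‖ ^ 2) + t ^ 2 * ‖p.1 - w.1‖ ^ 2 := by
      rw [show (1 - t) • w.1 + t • p.1 = w.1 + t • (p.1 - w.1) by module, norm_add_sq_real,
        norm_smul, inner_smul_right, inner_sub_right, real_inner_self_eq_norm_sq, mul_pow,
        Real.norm_eq_abs, sq_abs]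
      ring
    simp only [Prod.snd_add, Prod.fst_add, Prod.smul_fst, Prod.smul_snd, smul_eq_mul, h2] at h
    refine le_of_mul_le_mul_left ?_ ht0
    linarith
  have hlim : Tendsto (fun t : ℝ => p.2 + ⟪w.1, p.1⟫_ℝ + t * (‖p.1 - w.1‖ ^ 2 / 2)) (𝓝[>] 0)
      (𝓝 (p.2 + ⟪w.1, p.1⟫_ℝ)) := by
    have : Continuous fun t : ℝ => p.2 + ⟪w.1, p.1⟫_ℝ + t * (‖p.1 - w.1‖ ^ 2 / 2) := by fun_prop
    simpa using (this.tendsto 0).mono_left nhdsWithin_le_nhds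
  exact ge_of_tendsto hlim
    (eventually_of_mem (Ioo_mem_nhdsGT one_pos) key)

/-! ### Exchange of components along `V` and `Vᗮ`. -/

theorem Submodule.starProjection_add_orthogonal_starProjection {E : Type*}
    [NormedAddCommGroup E] [InnerProductSpace ℝ E] (V : Submodule ℝ E)
    [V.HasOrthogonalProjection] (y v : E) :
    V.starProjection (V.starProjection y + Vᗮ.starProjection v) = V.starProjection y := by
  rw [map_add, V.starProjection_eq_self_iff.2 (V.starProjection_apply_mem y),
    V.starProjection_apply_eq_zero_iff.2 (Vᗮ.starProjection_apply_mem v), add_zero]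

theorem Submodule.orthogonal_starProjection_starProjection_add {E : Type*}
    [NormedAddCommGroup E] [InnerProductSpace ℝ E] (V : Submodule ℝ E)
    [V.HasOrthogonalProjection] (y v : E) :
    Vᗮ.starProjection (V.starProjection y + Vᗮ.starProjection v) = Vᗮ.starProjection v := by
  rw [map_add, Vᗮ.starProjection_eq_self_iff.2 (Vᗮ.starProjection_apply_mem v),
    Vᗮ.starProjection_apply_eq_zero_iff.2
      (V.le_orthogonal_orthogonal (V.starProjection_apply_mem y)), zero_add]

/-- Exchanging the `Vᗮ`-components of a pair is an involution, so the partial inverse has the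
original graph as its own exchanged graph. -/
theorem Submodule.starProjection_add_starProjection_add_orthogonal {E : Type*}
    [NormedAddCommGroup E] [InnerProductSpace ℝ E] (V : Submodule ℝ E)
    [V.HasOrthogonalProjection] (y v : E) :
    V.starProjection (V.starProjection y + Vᗮ.starProjection v)
      + Vᗮ.starProjection (V.starProjection v + Vᗮ.starProjection y) = y := by
  rw [V.starProjection_add_orthogonal_starProjection,
    V.orthogonal_starProjection_starProjection_add,
    V.starProjection_add_starProjection_orthogonal]

/-! ### Maximal monotonicity, Minty's theorem, resolvents and partial inverses. -/

namespace SetValued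

variable {E : Type*} [NormedAddCommGroup E] [InnerProductSpace ℝ E]

theorem IsMaximallyMonotone.isMonotone {A : E → Set E} (hA : IsMaximallyMonotone A) :
    IsMonotone A :=
  fun x u hu => (hA x u).1 hu

theorem IsMaximallyMonotone.graph_nonempty {A : E → Set E} (hA : IsMaximallyMonotone A) :
    ∃ x u, u ∈ A x := by
  by_contra! h
  exact h 0 0 ((hA 0 0).2 fun y v hv => (h y v hv).elim)

theorem IsMaximallyMonotone.translate {A : E → Set E} (hA : IsMaximallyMonotone A) (w : E) :
    IsMaximallyMonotone fun x => {u | u + w ∈ A x} := by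
  intro x u
  refine ⟨fun h y v hv => ?_, fun h => (hA _ _).2 fun y v hv => ?_⟩
  · simpa using (hA _ _).1 h y _ hv
  · have := h y (v - w) (by simpa using hv)
    rwa [show u - (v - w) = u + w - v by abel] at this

/-- Minty's theorem at the origin. -/
theorem IsMaximallyMonotone.exists_neg_mem [CompleteSpace E] {A : E → Set E}
    (hA : IsMaximallyMonotone A) : ∃ x, -x ∈ A x := by
  -- This is the epigraph of the Fitzpatrick function of `A`, closed and convex as an intersection
  -- of half-spaces.
  set S : Set (WithLp 2 (E × E) × ℝ) :=
    {p | ∀ y, ∀ v ∈ A y, ⟪y, p.1.snd⟫_ℝ + ⟪p.1.fst, v⟫_ℝ - ⟪y, v⟫_ℝ ≤ p.2} with hS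
  have hconv : Convex ℝ S := by
    intro p hp q hq a b ha hb hab y v hv
    have h1 := mul_le_mul_of_nonneg_left (hp y v hv) ha
    have h2 := mul_le_mul_of_nonneg_left (hq y v hv) hb
    simp only [Prod.fst_add, Prod.smul_fst, WithLp.add_snd, WithLp.smul_snd, WithLp.add_fst,
      WithLp.smul_fst, inner_add_right, inner_add_left, real_inner_smul_left,
      real_inner_smul_right, Prod.snd_add, Prod.smul_snd, smul_eq_mul]
    have h3 : ⟪y, v⟫_ℝ = a * ⟪y, v⟫_ℝ + b * ⟪y, v⟫_ℝ := by rw [← add_mul, hab, one_mul]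
    linarith
  have hclosed : IsClosed S := by
    simp only [hS, Set.ofPred_forall]
    refine isClosed_iInter fun y => isClosed_iInter fun v => isClosed_iInter fun _ =>
      isClosed_le ?_ continuous_snd
    fun_prop
  have hmem : ∀ y, ∀ v ∈ A y, ((WithLp.toLp 2 (y, v) : WithLp 2 (E × E)), ⟪y, v⟫_ℝ) ∈ S := by
    intro y v hv y' v' hv'
    have := hA.isMonotone y v hv y' v' hv'
    simp only [inner_sub_left, inner_sub_right] at this
    simp only [WithLp.toLp_fst, WithLp.toLp_snd]
    linarith
  -- The Fitzpatrick function dominates the duality product. Off the graph, maximality supplies a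
  -- point with negative monotonicity product, which witnesses the inequality.
  have hle : ∀ p ∈ S, ⟪p.1.fst, p.1.snd⟫_ℝ ≤ p.2 := by
    intro p hp
    by_cases h : p.1.snd ∈ A p.1.fst
    · simpa using hp _ _ h
    · rw [hA] at h
      push Not at h
      obtain ⟨y, v, hv, h⟩ := h
      have := hp y v hv
      simp only [inner_sub_left, inner_sub_right] at h
      linarith
  have hsum : ∀ z : WithLp 2 (E × E),
      ⟪z.fst, z.snd⟫_ℝ + ‖z‖ ^ 2 / 2 = ‖z.fst + z.snd‖ ^ 2 / 2 := by
    intro z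
    rw [WithLp.prod_norm_sq_eq_of_L2, norm_add_sq_real]
    ring
  obtain ⟨x₀, u₀, h₀⟩ := hA.graph_nonempty
  obtain ⟨w, hw, hmin⟩ := exists_forall_add_norm_sq_le hclosed hconv ⟨_, hmem x₀ u₀ h₀⟩
    fun p hp => by
      have h1 := hle p hp
      have h2 := hsum p.1
      have : 0 ≤ ‖p.1.fst + p.1.snd‖ ^ 2 / 2 := by positivity
      linarith
  -- Optimality at graph points shows that `(-w.1.snd, -w.1.fst)` is monotonically related to the
  -- graph, hence lies in it. Testing that point against itself then forces `w.1.snd = -w.1.fst`.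
  have key : ∀ y, ∀ v ∈ A y, ‖w.1.fst + w.1.snd‖ ^ 2 / 2 ≤ ⟪-w.1.snd - y, -w.1.fst - v⟫_ℝ := by
    intro y v hv
    have h1 := add_inner_le_of_forall_add_norm_sq_le hconv hw hmin (hmem y v hv)
    have h2 := hle w hw
    have h3 := hsum w.1
    have h4 := sq_nonneg ‖w.1.fst + w.1.snd‖
    rw [WithLp.prod_inner_apply] at h1
    change _ ≤ ⟪y, v⟫_ℝ + (⟪w.1.fst, y⟫_ℝ + ⟪w.1.snd, v⟫_ℝ) at h1
    simp only [inner_sub_left, inner_sub_right, inner_neg_left, inner_neg_right]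
    rw [real_inner_comm w.1.fst w.1.snd, real_inner_comm w.1.fst y]
    linarith
  have hin : -w.1.fst ∈ A (-w.1.snd) := by
    refine (hA _ _).2 fun y v hv => le_trans (by positivity) (key y v hv)
  have h0 := key _ _ hin
  have h1 : ‖w.1.fst + w.1.snd‖ ^ 2 = 0 :=
    le_antisymm (by simp at h0; linarith) (by positivity)
  have h2 : w.1.snd = -w.1.fst := by
    rw [eq_neg_iff_add_eq_zero, add_comm]
    simpa using h1
  exact ⟨w.1.fst, by simpa [h2] using hin⟩

/-- Minty's theorem: `Id + A` is surjective when `A` is maximally monotone. -/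
theorem IsMaximallyMonotone.exists_sub_mem [CompleteSpace E] {A : E → Set E}
    (hA : IsMaximallyMonotone A) (w : E) : ∃ x, w - x ∈ A x := by
  obtain ⟨x, hx⟩ := (hA.translate w).exists_neg_mem
  exact ⟨x, by simpa [sub_eq_neg_add] using hx⟩

/-- Nonexpansiveness of the resolvent: monotonicity gives `‖x - x'‖² ≤ ⟪x - x', w - w'⟫`, and
Cauchy–Schwarz concludes. -/
theorem IsMonotone.norm_sub_le_of_sub_mem {A : E → Set E} (hA : IsMonotone A) {w w' x x' : E}
    (hx : w - x ∈ A x) (hx' : w' - x' ∈ A x') : ‖x - x'‖ ≤ ‖w - w'‖ := by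
  have h := hA _ _ hx _ _ hx'
  rw [show w - x - (w' - x') = (w - w') - (x - x') by abel, inner_sub_right,
    real_inner_self_eq_norm_sq] at h
  have h2 := real_inner_le_norm (x - x') (w - w')
  by_contra! h3
  have := norm_nonneg (w - w')
  nlinarith

theorem IsMonotone.eq_of_sub_mem {A : E → Set E} (hA : IsMonotone A) {w x x' : E}
    (hx : w - x ∈ A x) (hx' : w - x' ∈ A x') : x = x' := by
  have := hA.norm_sub_le_of_sub_mem hx hx'
  rwa [sub_self, norm_zero, norm_le_zero_iff, sub_eq_zero] at this

theorem mem_setResolvent {E : Type*} [NormedAddCommGroup E] [InnerProductSpace ℝ E]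
    {A : E → Set E} {w x : E} : x ∈ setResolvent A w ↔ w - x ∈ A x := by
  simp only [setResolvent, inv, Set.mem_ofPred_eq, Set.singleton_add, Set.mem_image]
  constructor
  · rintro ⟨a, ha, rfl⟩
    simpa using ha
  · exact fun h => ⟨_, h, by abel⟩

theorem IsMaximallyMonotone.inv {A : E → Set E} (hA : IsMaximallyMonotone A) :
    IsMaximallyMonotone (inv A) := by
  intro x u
  refine (hA u x).trans ⟨fun h y v hv => ?_, fun h y v hv => ?_⟩
  · rw [real_inner_comm]; exact h v y hv
  · rw [real_inner_comm]; exact h v y hv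

theorem IsMaximallyMonotone.smul {A : E → Set E} (hA : IsMaximallyMonotone A) {γ : ℝ}
    (hγ : 0 < γ) : IsMaximallyMonotone (γ • A) := by
  intro x u
  rw [Pi.smul_apply, Set.mem_smul_set_iff_inv_smul_mem₀ hγ.ne', hA]
  refine ⟨fun h y v hv => ?_, fun h y v hv => ?_⟩
  · rw [Pi.smul_apply, Set.mem_smul_set_iff_inv_smul_mem₀ hγ.ne'] at hv
    have := h y _ hv
    rw [← smul_sub, inner_smul_right] at this
    exact nonneg_of_mul_nonneg_right this (inv_pos.2 hγ)
  · have := h y (γ • v) (Set.smul_mem_smul_set hv)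
    rw [show u - γ • v = γ • (γ⁻¹ • u - v) by rw [smul_sub, smul_inv_smul₀ hγ.ne'],
      inner_smul_right] at this
    exact nonneg_of_mul_nonneg_right this hγ

/-- Strong monotonicity makes `δ⁻¹ D - Id` monotone, and it inherits maximality from `D`; Minty's
theorem for this operator at `δ⁻¹ • u` gives the preimage. -/
theorem IsMaximallyMonotone.exists_mem_of_isStronglyMonotone [CompleteSpace E] {D : E → Set E}
    (hD : IsMaximallyMonotone D) {δ : ℝ} (hδ : 0 < δ) (hDδ : IsStronglyMonotone δ D) (u : E) :
    ∃ x, u ∈ D x := by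
  have hmax : IsMaximallyMonotone fun x => {v | δ • (v + x) ∈ D x} := by
    intro x v
    refine ⟨fun h y w hw => ?_, fun h => (hD _ _).2 fun y w hw => ?_⟩
    · have := hDδ _ _ h _ _ hw
      rw [← smul_sub, inner_smul_right, show v + x - (w + y) = (v - w) + (x - y) by abel,
        inner_add_right, real_inner_self_eq_norm_sq] at this
      nlinarith
    · have := h y (δ⁻¹ • w - y) (by simpa [smul_sub, smul_inv_smul₀ hδ.ne'] using hw)
      rw [show δ • (v + x) - w = δ • (v - (δ⁻¹ • w - y) + (x - y)) by
        simp only [smul_add, smul_sub, smul_inv_smul₀ hδ.ne']; abel, inner_smul_right,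
        inner_add_right, real_inner_self_eq_norm_sq]
      positivity
  obtain ⟨x, hx⟩ := hmax.exists_sub_mem (δ⁻¹ • u)
  exact ⟨x, by simpa [smul_sub, smul_inv_smul₀ hδ.ne'] using hx⟩

/-- The inverse of a maximally monotone, `δ`-strongly monotone operator is single-valued,
everywhere defined and `δ`-cocoercive. -/
theorem IsMaximallyMonotone.exists_inv_eq_singleton [CompleteSpace E] {D : E → Set E}
    (hD : IsMaximallyMonotone D) {δ : ℝ} (hδ : 0 < δ) (hDδ : IsStronglyMonotone δ D) :
    ∃ T : E → E, (∀ u, SetValued.inv D u = {T u}) ∧ IsCocoercive δ T := by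
  choose T hT using hD.exists_mem_of_isStronglyMonotone hδ hDδ
  refine ⟨T, fun u => Set.eq_singleton_iff_unique_mem.2 ⟨hT u, fun x hx => ?_⟩, fun u v => ?_⟩
  · have h := hDδ _ _ hx _ _ (hT u)
    rw [sub_self, inner_zero_right] at h
    have h2 : ‖x - T u‖ ^ 2 ≤ 0 := nonpos_of_mul_nonpos_right h hδ
    have h3 : ‖x - T u‖ = 0 := by simpa using le_antisymm h2 (by positivity)
    exact sub_eq_zero.1 (norm_eq_zero.1 h3)
  · rw [real_inner_comm]
    exact hDδ _ _ (hT u) _ _ (hT v)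

/-- The sum of a maximally monotone operator and an everywhere defined, monotone and
Lipschitzian operator is maximally monotone. -/
theorem IsMaximallyMonotone.add_lipschitz [CompleteSpace E] {A : E → Set E}
    (hA : IsMaximallyMonotone A) {F : E → E} (hF : ∀ x y, 0 ≤ ⟪x - y, F x - F y⟫_ℝ) {K : ℝ≥0}
    (hK : LipschitzWith K F) : IsMaximallyMonotone fun x => {u | u - F x ∈ A x} := by
  intro x u
  refine ⟨fun h y v hv => ?_, fun h => ?_⟩
  · have h1 := hA.isMonotone _ _ h _ _ hv
    have h2 := hF x y
    rw [show u - F x - (v - F y) = (u - v) - (F x - F y) by abel, inner_sub_right] at h1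
    linarith
  -- This step makes `c * K < 1`, so Banach's theorem yields `y` with `u + c⁻¹ (x - y)` in the sum
  -- at `y`. Testing `(x, u)` against this point gives `-c⁻¹ ‖x - y‖² ≥ 0`, so `y = x`.
  set c : ℝ≥0 := (K + 1)⁻¹ with hc
  have hc0 : 0 < c := by positivity
  choose J hJ using (hA.smul (γ := c) (by exact_mod_cast hc0)).exists_sub_mem
  have hcontr : ContractingWith (c * K) fun y => J (x + (c : ℝ) • u - (c : ℝ) • F y) := by
    refine ⟨?_, LipschitzWith.of_dist_le_mul fun y z => ?_⟩
    · rw [hc, inv_mul_lt_iff₀ (by positivity), mul_one]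
      exact lt_add_one K
    · have h1 := (hA.smul (γ := c) (by exact_mod_cast hc0)).isMonotone.norm_sub_le_of_sub_mem
        (hJ (x + (c : ℝ) • u - (c : ℝ) • F y)) (hJ (x + (c : ℝ) • u - (c : ℝ) • F z))
      rw [show x + (c : ℝ) • u - (c : ℝ) • F y - (x + (c : ℝ) • u - (c : ℝ) • F z)
        = (c : ℝ) • (F z - F y) by rw [smul_sub]; abel, norm_smul, ← dist_eq_norm,
        ← dist_eq_norm, dist_comm (F z)] at h1
      refine h1.trans ?_
      rw [NNReal.coe_mul, mul_assoc, NNReal.norm_eq]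
      exact mul_le_mul_of_nonneg_left (hK.dist_le_mul y z) c.2
  obtain ⟨y, hy⟩ : ∃ y, J (x + (c : ℝ) • u - (c : ℝ) • F y) = y :=
    ⟨_, hcontr.fixedPoint_isFixedPt⟩
  have hy2 := hJ (x + (c : ℝ) • u - (c : ℝ) • F y)
  have hc0' : (0 : ℝ) < c := by exact_mod_cast hc0
  rw [hy, Pi.smul_apply, Set.mem_smul_set_iff_inv_smul_mem₀ hc0'.ne',
    show (c : ℝ)⁻¹ • (x + (c : ℝ) • u - (c : ℝ) • F y - y)
      = (u + (c : ℝ)⁻¹ • (x - y)) - F y by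
    simp only [smul_add, smul_sub, inv_smul_smul₀ hc0'.ne']; abel] at hy2
  have h3 := h y _ hy2
  rw [sub_add_cancel_left, inner_neg_right, inner_smul_right, real_inner_self_eq_norm_sq,
    neg_nonneg] at h3
  have h4 : ‖x - y‖ ^ 2 ≤ 0 := nonpos_of_mul_nonpos_right h3 (inv_pos.2 hc0')
  have h5 : x = y := by
    rw [← sub_eq_zero, ← norm_eq_zero]
    simpa using le_antisymm h4 (by positivity)
  subst h5
  simpa using hy2

/-- The partial inverse (in the sense of Spingarn) of a set-valued operator with respect to a
subspace. -/
noncomputable def partialInverse (A : E → Set E) (V : Submodule ℝ E)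
    [V.HasOrthogonalProjection] : E → Set E :=
  fun x => {u | V.starProjection u + Vᗮ.starProjection x
    ∈ A (V.starProjection x + Vᗮ.starProjection u)}

/-- Exchanging `Vᗮ`-components is a linear involution of `E × E` preserving `⟪a, b⟫`, because the
cross terms vanish. It therefore preserves being monotonically related. -/
theorem IsMaximallyMonotone.partialInverse {A : E → Set E} (hA : IsMaximallyMonotone A)
    (V : Submodule ℝ E) [V.HasOrthogonalProjection] :
    IsMaximallyMonotone (partialInverse A V) := by
  have hswap : ∀ a b : E, ⟪V.starProjection a + Vᗮ.starProjection b,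
      V.starProjection b + Vᗮ.starProjection a⟫_ℝ = ⟪a, b⟫_ℝ := by
    intro a b
    have e : ∀ c d : E, ⟪V.starProjection c, Vᗮ.starProjection d⟫_ℝ = 0 := fun c d =>
      V.inner_right_of_mem_orthogonal (V.starProjection_apply_mem c)
        (Vᗮ.starProjection_apply_mem d)
    have e' : ∀ c d : E, ⟪Vᗮ.starProjection d, V.starProjection c⟫_ℝ = 0 := fun c d =>
      V.inner_left_of_mem_orthogonal (V.starProjection_apply_mem c)
        (Vᗮ.starProjection_apply_mem d)
    conv_rhs => rw [← V.starProjection_add_starProjection_orthogonal a,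
      ← V.starProjection_add_starProjection_orthogonal b]
    simp only [inner_add_left, inner_add_right, e, e', add_zero, zero_add]
    rw [real_inner_comm (Vᗮ.starProjection a)]
  intro x u
  refine (hA _ _).trans ⟨fun h y v hv => ?_, fun h y v hv => ?_⟩
  · have := h _ _ hv
    rwa [add_sub_add_comm, add_sub_add_comm, ← map_sub, ← map_sub, ← map_sub, ← map_sub,
      hswap] at this
  · have h1 := V.starProjection_add_starProjection_add_orthogonal y v
    have h2 := V.starProjection_add_starProjection_add_orthogonal v y
    have := h (V.starProjection y + Vᗮ.starProjection v)
      (V.starProjection v + Vᗮ.starProjection y) (by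
        simp only [SetValued.partialInverse, Set.mem_ofPred_eq, h1, h2]; exact hv)
    rw [← hswap, map_sub, map_sub, map_sub, map_sub, ← add_sub_add_comm, ← add_sub_add_comm,
      h1, h2] at this
    exact this

end SetValued

/-! ### Weak compactness along ultrafilters and Opial's lemma. -/

section WeakLimits

variable {E : Type*} [NormedAddCommGroup E] [InnerProductSpace ℝ E]

theorem weaklyConverges_of_forall_inner [CompleteSpace E] {x : ℕ → E} {a : E}
    (h : ∀ y, Tendsto (fun n => ⟪x n, y⟫_ℝ) atTop (𝓝 ⟪a, y⟫_ℝ)) : WeaklyConverges x a := by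
  unfold WeaklyConverges
  refine (WeakBilin.tendsto_iff_forall_eval_tendsto (B := (topDualPairing ℝ E).flip) ?_).2 ?_
  · intro u v huv
    rw [← sub_eq_zero, ← inner_self_eq_zero (𝕜 := ℝ)]
    have := LinearMap.congr_fun huv (innerSL ℝ (u - v))
    simp only [LinearMap.flip_apply, topDualPairing_apply, innerSL_apply_apply] at this
    rw [inner_sub_right, this, sub_self]
  · intro f
    have := h ((InnerProductSpace.toDual ℝ E).symm f)
    simp only [real_inner_comm ((InnerProductSpace.toDual ℝ E).symm f),
      InnerProductSpace.toDual_symm_apply] at this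
    exact this

/-- Bounded families in a Hilbert space converge weakly along ultrafilters. -/
theorem exists_tendsto_inner_of_norm_le [CompleteSpace E] {ι : Type*} {x : ι → E} {R : ℝ}
    (hx : ∀ i, ‖x i‖ ≤ R) (𝒰 : Ultrafilter ι) :
    ∃ a, ∀ y, Tendsto (fun i => ⟪x i, y⟫_ℝ) 𝒰 (𝓝 ⟪a, y⟫_ℝ) := by
  have hmem : ∀ y i, ⟪x i, y⟫_ℝ ∈ Set.Icc (-(R * ‖y‖)) (R * ‖y‖) := fun y i =>
    abs_le.1 ((abs_real_inner_le_norm _ _).trans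
      (mul_le_mul_of_nonneg_right (hx i) (norm_nonneg y)))
  have hlim : ∀ y, ∃ c ∈ Set.Icc (-(R * ‖y‖)) (R * ‖y‖),
      Tendsto (fun i => ⟪x i, y⟫_ℝ) 𝒰 (𝓝 c) := by
    intro y
    exact isCompact_Icc.ultrafilter_le_nhds' (𝒰.map fun i => ⟪x i, y⟫_ℝ)
      (Ultrafilter.mem_map.2 (Filter.univ_mem' (hmem y)))
  choose f hf hlim using hlim
  -- The scalar limits form a linear functional bounded by `R`, and its Riesz representative is the
  -- weak limit.
  let φ : E →ₗ[ℝ] ℝ :=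
    { toFun := f
      map_add' := fun y z => tendsto_nhds_unique (hlim (y + z))
        (((hlim y).add (hlim z)).congr fun i => (inner_add_right _ _ _).symm)
      map_smul' := fun c y => tendsto_nhds_unique (hlim (c • y))
        (((hlim y).const_mul c).congr fun i => (inner_smul_right _ _ _).symm) }
  let ψ : E →L[ℝ] ℝ := φ.mkContinuous R fun y => abs_le.2 (hf y)
  refine ⟨(InnerProductSpace.toDual ℝ E).symm ψ, fun y => ?_⟩
  rw [InnerProductSpace.toDual_symm_apply]
  exact hlim y

/-- Opial's lemma: a sequence whose distance to every point of `Z` is nonincreasing and whose weak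
cluster points belong to `Z` converges weakly to a point of `Z`. -/
theorem exists_tendsto_inner_of_fejer [CompleteSpace E] {Z : Set E} (hZ : Z.Nonempty) {x : ℕ → E}
    (hF : ∀ z ∈ Z, Antitone fun n => ‖x n - z‖)
    (hcl : ∀ 𝒰 : Ultrafilter ℕ, (𝒰 : Filter ℕ) ≤ atTop → ∀ a,
      (∀ y, Tendsto (fun n => ⟪x n, y⟫_ℝ) 𝒰 (𝓝 ⟪a, y⟫_ℝ)) → a ∈ Z) :
    ∃ a ∈ Z, ∀ y, Tendsto (fun n => ⟪x n, y⟫_ℝ) atTop (𝓝 ⟪a, y⟫_ℝ) := by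
  have hnorm : ∀ z ∈ Z, ∃ c, Tendsto (fun n => ‖x n - z‖) atTop (𝓝 c) := fun z hz =>
    ⟨_, tendsto_atTop_ciInf (hF z hz) ⟨0, by rintro _ ⟨n, rfl⟩; exact norm_nonneg _⟩⟩
  have hdiff : ∀ z ∈ Z, ∀ z' ∈ Z, ∃ c, Tendsto (fun n => ⟪x n, z - z'⟫_ℝ) atTop (𝓝 c) := by
    intro z hz z' hz'
    obtain ⟨c, hc⟩ := hnorm z hz
    obtain ⟨c', hc'⟩ := hnorm z' hz'
    refine ⟨_, ((((hc'.pow 2).sub (hc.pow 2)).add_const (‖z‖ ^ 2 - ‖z'‖ ^ 2)).div_const 2).congr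
      fun n => ?_⟩
    simp only [norm_sub_sq_real, inner_sub_right]
    ring
  obtain ⟨z₀, hz₀⟩ := hZ
  have hbd : ∀ n, ‖x n‖ ≤ ‖x 0 - z₀‖ + ‖z₀‖ := fun n => by
    have h1 := hF z₀ hz₀ (Nat.zero_le n)
    have h2 := norm_le_norm_sub_add (x n) z₀
    simp only at h1
    linarith
  obtain ⟨a, ha⟩ := exists_tendsto_inner_of_norm_le hbd (Ultrafilter.of (atTop : Filter ℕ))
  have haZ := hcl _ (Ultrafilter.of_le _) a ha
  refine ⟨a, haZ, fun y => (tendsto_iff_ultrafilter _ _ _).2 fun 𝒰 h𝒰 => ?_⟩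
  obtain ⟨b, hb⟩ := exists_tendsto_inner_of_norm_le hbd 𝒰
  have hbZ := hcl _ h𝒰 b hb
  -- The pairing with `a - b` converges along the whole sequence, because the distances to `a` and
  -- to `b` do. Both cluster points thus give it the same value, so `‖a - b‖² = 0`.
  obtain ⟨c, hc⟩ := hdiff a haZ b hbZ
  have h1 := tendsto_nhds_unique (ha (a - b)) (hc.mono_left (Ultrafilter.of_le _))
  have h2 := tendsto_nhds_unique (hb (a - b)) (hc.mono_left h𝒰)
  have h3 : a = b := by
    rw [← sub_eq_zero, ← inner_self_eq_zero (𝕜 := ℝ), inner_sub_left, h1, h2, sub_self]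
  rw [h3]
  exact hb y

end WeakLimits

/-! ### Forward-backward-half-forward iteration. -/

namespace SetValued

variable {E : Type*} [NormedAddCommGroup E] [InnerProductSpace ℝ E]

/-- The graph of a maximally monotone operator is closed for the weak topology on bounded subsets
of the domain and the strong topology on the range. -/
theorem IsMaximallyMonotone.mem_of_tendsto_inner {A : E → Set E} (hA : IsMaximallyMonotone A)
    {ι : Type*} {l : Filter ι} [l.NeBot] {w v : ι → E} {a b : E} {R : ℝ}
    (hmem : ∀ i, v i ∈ A (w i)) (hR : ∀ i, ‖w i‖ ≤ R)
    (hw : ∀ y, Tendsto (fun i => ⟪w i, y⟫_ℝ) l (𝓝 ⟪a, y⟫_ℝ)) (hv : Tendsto v l (𝓝 b)) :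
    b ∈ A a := by
  refine (hA _ _).2 fun y u hu => ?_
  have h1 : Tendsto (fun i => ⟪w i - y, v i - b⟫_ℝ) l (𝓝 0) := by
    refine squeeze_zero_norm (a := fun i => (R + ‖y‖) * ‖v i - b‖) (fun i => ?_) ?_
    · refine (norm_inner_le_norm _ _).trans (mul_le_mul_of_nonneg_right ?_ (norm_nonneg _))
      exact (norm_sub_le _ _).trans (by linarith [hR i])
    · simpa using ((hv.sub_const b).norm).const_mul (R + ‖y‖)
  have h2 : Tendsto (fun i => ⟪w i - y, v i - u⟫_ℝ) l (𝓝 ⟪a - y, b - u⟫_ℝ) := by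
    have := h1.add ((hw (b - u)).sub_const ⟪y, b - u⟫_ℝ)
    rw [zero_add, ← inner_sub_left] at this
    refine this.congr fun i => ?_
    rw [← inner_sub_left, ← inner_add_right, sub_add_sub_cancel]
  exact ge_of_tendsto' h2 fun i => hA.isMonotone _ _ (hmem i) _ _ hu

theorem IsCocoercive.inner_nonneg {C : E → E} {κ : ℝ} (hκ : 0 ≤ κ) (hC : IsCocoercive κ C)
    (x y : E) : 0 ≤ ⟪x - y, C x - C y⟫_ℝ :=
  le_trans (by positivity) (hC x y)

theorem IsCocoercive.lipschitzWith {C : E → E} {κ : ℝ} (hκ : 0 < κ) (hC : IsCocoercive κ C) :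
    LipschitzWith (Real.toNNReal κ⁻¹) C := by
  refine LipschitzWith.of_dist_le_mul fun x y => ?_
  rw [Real.coe_toNNReal _ (inv_pos.2 hκ).le, dist_eq_norm, dist_eq_norm, ← div_eq_inv_mul,
    le_div_iff₀ hκ]
  have h := (hC x y).trans (real_inner_le_norm _ _)
  rcases (norm_nonneg (C x - C y)).eq_or_lt with h0 | h0
  · rw [← h0]; simp
  · nlinarith

/-- The basic Fejér-type inequality for the forward-backward-half-forward iteration. -/
theorem norm_sq_add_le_of_forwardBackwardHalfForward {A : E → Set E} (hA : IsMonotone A)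
    {F₁ F₂ : E → E} (hF₁ : ∀ x y, 0 ≤ ⟪x - y, F₁ x - F₁ y⟫_ℝ) {K : ℝ≥0} (hK : LipschitzWith K F₁)
    {κ : ℝ} (hκ : 0 < κ) (hF₂ : IsCocoercive κ F₂) {x w z : E}
    (hz : -(F₁ z + F₂ z) ∈ A z) (hw : x - (F₁ x + F₂ x) - w ∈ A w) :
    ‖w - (F₁ w - F₁ x) - z‖ ^ 2 + (1 - K ^ 2 - 1 / (2 * κ)) * ‖x - w‖ ^ 2 ≤ ‖x - z‖ ^ 2 := by
  have h1 := hA _ _ hw _ _ hz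
  have h2 := hF₁ w z
  have h3 := hF₂ x z
  have h4 : ‖F₁ w - F₁ x‖ ^ 2 ≤ K ^ 2 * ‖x - w‖ ^ 2 := by
    rw [← mul_pow]
    gcongr
    rw [norm_sub_rev x]
    simpa [dist_eq_norm] using hK.dist_le_mul w x
  -- Young's inequality weighted so that the `‖F₂ x - F₂ z‖²` term is exactly the one absorbed by
  -- cocoercivity.
  have h5 : 2 * ⟪x - w, F₂ x - F₂ z⟫_ℝ
      ≤ 1 / (2 * κ) * ‖x - w‖ ^ 2 + 2 * κ * ‖F₂ x - F₂ z‖ ^ 2 := by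
    have h := real_inner_le_norm (x - w) (F₂ x - F₂ z)
    have h6 : 0 ≤ 1 / (2 * κ) * (‖x - w‖ - 2 * κ * ‖F₂ x - F₂ z‖) ^ 2 := by positivity
    have h7 : 1 / (2 * κ) * (‖x - w‖ - 2 * κ * ‖F₂ x - F₂ z‖) ^ 2
        = 1 / (2 * κ) * ‖x - w‖ ^ 2 - 2 * (‖x - w‖ * ‖F₂ x - F₂ z‖)
          + 2 * κ * ‖F₂ x - F₂ z‖ ^ 2 := by
      field_simp
      ring
    linarith
  have e1 : ‖w - (F₁ w - F₁ x) - z‖ ^ 2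
      = ‖w - z‖ ^ 2 - 2 * ⟪w - z, F₁ w - F₁ x⟫_ℝ + ‖F₁ w - F₁ x‖ ^ 2 := by
    rw [← norm_sub_sq_real]
    congr 2
    abel
  have e2 : ‖x - z‖ ^ 2 = ‖x - w‖ ^ 2 + 2 * ⟪w - z, x - w⟫_ℝ + ‖w - z‖ ^ 2 := by
    rw [real_inner_comm, ← norm_add_sq_real, sub_add_sub_cancel]
  have e3 : ⟪x - z, F₂ x - F₂ z⟫_ℝ = ⟪x - w, F₂ x - F₂ z⟫_ℝ + ⟪w - z, F₂ x - F₂ z⟫_ℝ := by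
    rw [← inner_add_left, sub_add_sub_cancel]
  have e4 : ⟪w - z, x - (F₁ x + F₂ x) - w - -(F₁ z + F₂ z)⟫_ℝ
      = ⟪w - z, x - w⟫_ℝ + ⟪w - z, F₁ w - F₁ x⟫_ℝ - ⟪w - z, F₁ w - F₁ z⟫_ℝ
        - ⟪w - z, F₂ x - F₂ z⟫_ℝ := by
    rw [← inner_add_right, ← inner_sub_right, ← inner_sub_right]
    congr 1
    abel
  linarith

/-- Weak convergence of the forward-backward-half-forward algorithm with unit step size. -/
theorem exists_tendsto_inner_of_forwardBackwardHalfForward [CompleteSpace E] {A : E → Set E}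
    (hA : IsMaximallyMonotone A) {F₁ F₂ : E → E} (hF₁ : ∀ x y, 0 ≤ ⟪x - y, F₁ x - F₁ y⟫_ℝ)
    {K : ℝ≥0} (hK : LipschitzWith K F₁) {κ : ℝ} (hκ : 0 < κ) (hF₂ : IsCocoercive κ F₂)
    (hstep : (K : ℝ) ^ 2 + 1 / (2 * κ) < 1) (hZ : ∃ z, -(F₁ z + F₂ z) ∈ A z) {x w : ℕ → E}
    (hw : ∀ n, x n - (F₁ (x n) + F₂ (x n)) - w n ∈ A (w n))
    (hx : ∀ n, x (n + 1) = w n - (F₁ (w n) - F₁ (x n))) :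
    ∃ z, -(F₁ z + F₂ z) ∈ A z ∧ ∀ y, Tendsto (fun n => ⟪x n, y⟫_ℝ) atTop (𝓝 ⟪z, y⟫_ℝ) := by
  have hineq : ∀ z, -(F₁ z + F₂ z) ∈ A z → ∀ n, ‖x (n + 1) - z‖ ^ 2
      + (1 - K ^ 2 - 1 / (2 * κ)) * ‖x n - w n‖ ^ 2 ≤ ‖x n - z‖ ^ 2 := fun z hz n => by
    rw [hx]
    exact norm_sq_add_le_of_forwardBackwardHalfForward hA.isMonotone hF₁ hK hκ hF₂ hz (hw n)
  have hc : 0 < 1 - (K : ℝ) ^ 2 - 1 / (2 * κ) := by linarith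
  have hanti : ∀ z, -(F₁ z + F₂ z) ∈ A z → Antitone fun n => ‖x n - z‖ := fun z hz =>
    antitone_nat_of_succ_le fun n => by
      refine le_of_sq_le_sq ?_ (norm_nonneg _)
      have := hineq z hz n
      have h2 : 0 ≤ (1 - (K : ℝ) ^ 2 - 1 / (2 * κ)) * ‖x n - w n‖ ^ 2 := by positivity
      linarith
  obtain ⟨z₀, hz₀⟩ := hZ
  -- The positive multiple of `‖x n - w n‖²` is bounded by successive differences of a convergent
  -- sequence.
  have hxw : Tendsto (fun n => x n - w n) atTop (𝓝 0) := by
    obtain ⟨c, hlim⟩ : ∃ c, Tendsto (fun n => ‖x n - z₀‖) atTop (𝓝 c) :=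
      ⟨_, tendsto_atTop_ciInf (hanti z₀ hz₀) ⟨0, by rintro _ ⟨n, rfl⟩; exact norm_nonneg _⟩⟩
    have h1 : Tendsto (fun n => ‖x n - z₀‖ ^ 2 - ‖x (n + 1) - z₀‖ ^ 2) atTop (𝓝 0) := by
      simpa using (hlim.pow 2).sub (((tendsto_add_atTop_iff_nat 1).2 hlim).pow 2)
    have h2 : Tendsto (fun n => ‖x n - w n‖ ^ 2) atTop (𝓝 0) := by
      have h3 := h1.div_const (1 - (K : ℝ) ^ 2 - 1 / (2 * κ))
      rw [zero_div] at h3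
      refine squeeze_zero (fun n => by positivity) (fun n => ?_) h3
      rw [le_div_iff₀ hc]
      linarith [hineq z₀ hz₀ n]
    rw [tendsto_zero_iff_norm_tendsto_zero]
    simpa using h2.sqrt
  have hbx : ∀ n, ‖x n‖ ≤ ‖x 0 - z₀‖ + ‖z₀‖ := fun n => by
    have h1 := hanti z₀ hz₀ (Nat.zero_le n)
    have h2 := norm_le_norm_sub_add (x n) z₀
    simp only at h1
    linarith
  obtain ⟨r, hr⟩ := hxw.norm.bddAbove_range
  have hbw : ∀ n, ‖w n‖ ≤ r + (‖x 0 - z₀‖ + ‖z₀‖) := fun n => by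
    have h1 := hr ⟨n, rfl⟩
    have h2 := norm_le_norm_sub_add (w n) (x n)
    rw [norm_sub_rev] at h2
    simp only at h1
    linarith [hbx n]
  have hKF : LipschitzWith (K + Real.toNNReal κ⁻¹) fun y => F₁ y + F₂ y :=
    hK.add (hF₂.lipschitzWith hκ)
  have hmax : IsMaximallyMonotone fun y => {u | u - (F₁ y + F₂ y) ∈ A y} := by
    refine hA.add_lipschitz (F := fun y => F₁ y + F₂ y) (fun y y' => ?_) hKF
    rw [add_sub_add_comm, inner_add_right]
    exact add_nonneg (hF₁ _ _) (hF₂.inner_nonneg hκ.le _ _)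
  -- This residual is a value of the full sum at `w n`; it vanishes by Lipschitz continuity of `F₁ +
  -- F₂`.
  have hres : Tendsto (fun n => x n - w n + (F₁ (w n) + F₂ (w n) - (F₁ (x n) + F₂ (x n)))) atTop
      (𝓝 0) := by
    have : Tendsto (fun n => F₁ (w n) + F₂ (w n) - (F₁ (x n) + F₂ (x n))) atTop (𝓝 0) := by
      refine squeeze_zero_norm (fun n => ?_)
        (by simpa using hxw.norm.const_mul ((K + Real.toNNReal κ⁻¹ : ℝ≥0) : ℝ))
      rw [← dist_eq_norm, ← dist_eq_norm, dist_comm (x n)]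
      exact hKF.dist_le_mul (w n) (x n)
    simpa using hxw.add this
  refine exists_tendsto_inner_of_fejer (Z := {z | -(F₁ z + F₂ z) ∈ A z}) ⟨z₀, hz₀⟩ hanti
    fun 𝒰 h𝒰 a ha => ?_
  have h0 := hmax.mem_of_tendsto_inner (l := (𝒰 : Filter ℕ)) (w := w) (a := a) (b := 0)
    (v := fun n => x n - w n + (F₁ (w n) + F₂ (w n) - (F₁ (x n) + F₂ (x n))))
    (fun n => by
      rw [Set.mem_ofPred_eq]
      convert hw n using 1
      abel) hbw (fun y => ?_) (hres.mono_left h𝒰)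
  · simpa using h0
  · have h1 : Tendsto (fun n => ⟪x n - w n, y⟫_ℝ) 𝒰 (𝓝 0) := by
      simpa using (hxw.mono_left h𝒰).inner (tendsto_const_nhds (x := y))
    have := (ha y).sub h1
    rw [sub_zero] at this
    refine this.congr fun n => ?_
    rw [← inner_sub_left, sub_sub_cancel]

end SetValued

/-! ### Componentwise maximality and the normal cone of a subspace. -/

namespace SetValued

/-- A test point that decides membership and always contributes a nonpositive term. In a product,
nonnegativity of the sum then forces every summand to be nonnegative. -/
theorem IsMaximallyMonotone.exists_inner_nonpos {E : Type*} [NormedAddCommGroup E]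
    [InnerProductSpace ℝ E] {A : E → Set E} (hA : IsMaximallyMonotone A) (x u : E) :
    ∃ y, ∃ v ∈ A y, ⟪x - y, u - v⟫_ℝ ≤ 0 ∧ (0 ≤ ⟪x - y, u - v⟫_ℝ → u ∈ A x) := by
  by_cases h : u ∈ A x
  · exact ⟨x, u, h, by simp, fun _ => h⟩
  · have h' := h
    rw [hA] at h'
    push Not at h'
    obtain ⟨y, v, hv, h'⟩ := h'
    exact ⟨y, v, hv, h'.le, fun h2 => (h'.not_ge h2).elim⟩

theorem mem_normalCone_submodule {E : Type*} [NormedAddCommGroup E] [InnerProductSpace ℝ E]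
    {V : Submodule ℝ E} {x u : E} : u ∈ normalCone (V : Set E) x ↔ x ∈ V ∧ u ∈ Vᗮ := by
  refine ⟨fun h => ⟨h.1, (V.mem_orthogonal u).2 fun y hy => ?_⟩, fun h => ⟨h.1, fun y hy => ?_⟩⟩
  · have h1 := h.2 (x + y) (V.add_mem h.1 hy)
    have h2 := h.2 (x - y) (V.sub_mem h.1 hy)
    rw [add_sub_cancel_left] at h1
    rw [sub_sub_cancel_left, inner_neg_left] at h2
    linarith
  · exact (V.inner_right_of_mem_orthogonal (V.sub_mem hy h.1) h.2).le

end SetValued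

/-! ### Splitting operators on the product space. -/

namespace PrimalDual

open SetValued

section ProductSpace

variable {H : Type*} [NormedAddCommGroup H] [InnerProductSpace ℝ H]
  {m : ℕ} {G : Fin m → Type*} [∀ i, NormedAddCommGroup (G i)]
  [∀ i, InnerProductSpace ℝ (G i)]

/-- The Hilbert direct sum of the primal space and the dual spaces. -/
abbrev ProductSpace (H : Type*) {m : ℕ} (G : Fin m → Type*) : Type _ := WithLp 2 (H × PiLp 2 G)

/-- The point of the product space with given components. -/
abbrev mkProduct (x : H) (u : ∀ i, G i) : ProductSpace H G := WithLp.toLp 2 (x, WithLp.toLp 2 u)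

theorem inner_productSpace (z w : ProductSpace H G) :
    ⟪z, w⟫_ℝ = ⟪z.fst, w.fst⟫_ℝ + ∑ i, ⟪z.snd i, w.snd i⟫_ℝ := rfl

theorem norm_sq_productSpace {H : Type*} [NormedAddCommGroup H] {m : ℕ} {G : Fin m → Type*}
    [∀ i, NormedAddCommGroup (G i)] (z : ProductSpace H G) :
    ‖z‖ ^ 2 = ‖z.fst‖ ^ 2 + ∑ i, ‖z.snd i‖ ^ 2 := by
  rw [WithLp.prod_norm_sq_eq_of_L2, PiLp.norm_sq_eq_of_L2]

/-- The product of a set-valued operator on `H` and of set-valued operators on the `G i`. -/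
def productOperator (A : H → Set H) (B : ∀ i, G i → Set (G i)) :
    ProductSpace H G → Set (ProductSpace H G) :=
  fun z => {w | w.fst ∈ A z.fst ∧ ∀ i, w.snd i ∈ B i (z.snd i)}

theorem isMaximallyMonotone_productOperator {A : H → Set H} (hA : IsMaximallyMonotone A)
    {B : ∀ i, G i → Set (G i)} (hB : ∀ i, IsMaximallyMonotone (B i)) :
    IsMaximallyMonotone (productOperator A B) := by
  intro x u
  refine ⟨fun h y v hv => ?_, fun h => ?_⟩
  · rw [inner_productSpace]
    exact add_nonneg (hA.isMonotone _ _ h.1 _ _ hv.1)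
      (Finset.sum_nonneg fun i _ => (hB i).isMonotone _ _ (h.2 i) _ _ (hv.2 i))
  · obtain ⟨y, v, hv, hn, hm⟩ := hA.exists_inner_nonpos x.fst u.fst
    choose y' v' hv' hn' hm' using fun i => (hB i).exists_inner_nonpos (x.snd i) (u.snd i)
    have h1 := h (mkProduct y y') (mkProduct v v') ⟨hv, hv'⟩
    rw [inner_productSpace] at h1
    change 0 ≤ ⟪x.fst - y, u.fst - v⟫_ℝ + ∑ i, ⟪x.snd i - y' i, u.snd i - v' i⟫_ℝ at h1
    have h2 := Finset.sum_nonpos fun i (_ : i ∈ Finset.univ) => hn' i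
    refine ⟨hm (by linarith), fun i => hm' i ?_⟩
    have h3 := Finset.sum_le_sum_of_subset_of_nonpos' (f := fun i =>
      ⟪x.snd i - y' i, u.snd i - v' i⟫_ℝ) (Finset.subset_univ {i}) fun i _ _ => hn' i
    rw [Finset.sum_singleton] at h3
    linarith

/-- The cocoercive part of the primal-dual inclusion. -/
noncomputable def cocoercivePart (V : Submodule ℝ H) [V.HasOrthogonalProjection] (C : H → H)
    (D : ∀ i, G i → G i) (γ : ℝ) (z : ProductSpace H G) : ProductSpace H G :=
  γ • mkProduct (V.starProjection (C (V.starProjection z.fst))) (fun i => D i (z.snd i))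

variable (V : Submodule ℝ H) [V.HasOrthogonalProjection]

/-- The self-adjoint projector moves onto the difference of arguments, and its nonexpansiveness
preserves the constant. Scaling by `γ` divides that constant by `γ`. -/
theorem isCocoercive_cocoercivePart {C : H → H} {D : ∀ i, G i → G i} {β : ℝ} (hβ : 0 ≤ β)
    (hC : IsCocoercive β C) (hD : ∀ i, IsCocoercive β (D i)) {γ : ℝ} (hγ : 0 < γ) :
    IsCocoercive (β / γ) (cocoercivePart V C D γ) := by
  intro z w
  rw [cocoercivePart, cocoercivePart, ← smul_sub, inner_smul_right, norm_smul,
    Real.norm_of_nonneg hγ.le, mul_pow, show ∀ t : ℝ, β / γ * (γ ^ 2 * t) = γ * (β * t) by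
      intro t; field_simp]
  refine mul_le_mul_of_nonneg_left ?_ hγ.le
  rw [norm_sq_productSpace, inner_productSpace, mul_add, Finset.mul_sum]
  refine add_le_add ?_ (Finset.sum_le_sum fun i _ => hD i _ _)
  change β * ‖V.starProjection (C (V.starProjection z.fst))
      - V.starProjection (C (V.starProjection w.fst))‖ ^ 2
    ≤ ⟪z.fst - w.fst, V.starProjection (C (V.starProjection z.fst))
      - V.starProjection (C (V.starProjection w.fst))⟫_ℝ
  rw [← map_sub, ← V.inner_starProjection_left_eq_right, map_sub V.starProjection z.fst]
  refine le_trans ?_ (hC _ _)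
  gcongr
  exact V.norm_starProjection_apply_le _

variable [CompleteSpace H] [∀ i, CompleteSpace (G i)]

/-- The monotone Lipschitzian part of the primal-dual inclusion. -/
noncomputable def lipschitzPart (M : H → H)
    (N : ∀ i, G i → G i) (L : ∀ i, H →L[ℝ] G i) (γ : ℝ) (z : ProductSpace H G) :
    ProductSpace H G :=
  γ • (mkProduct (V.starProjection (M (V.starProjection z.fst))) (fun i => N i (z.snd i))
    + mkProduct (V.starProjection (∑ i, (L i).adjoint (z.snd i)))
      (fun i => -L i (V.starProjection z.fst)))

theorem lipschitzPart_monotone {M : H → H} (hM : ∀ x y, 0 ≤ ⟪x - y, M x - M y⟫_ℝ)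
    {N : ∀ i, G i → G i} (hN : ∀ i x y, 0 ≤ ⟪x - y, N i x - N i y⟫_ℝ) (L : ∀ i, H →L[ℝ] G i)
    {γ : ℝ} (hγ : 0 ≤ γ) (z w : ProductSpace H G) :
    0 ≤ ⟪z - w, lipschitzPart V M N L γ z - lipschitzPart V M N L γ w⟫_ℝ := by
  rw [lipschitzPart, lipschitzPart, ← smul_sub, inner_smul_right]
  refine mul_nonneg hγ ?_
  rw [add_sub_add_comm, inner_add_right]
  refine add_nonneg ?_ (le_of_eq ?_)
  · rw [inner_productSpace]
    refine add_nonneg ?_ (Finset.sum_nonneg fun i _ => hN i _ _)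
    change 0 ≤ ⟪z.fst - w.fst, V.starProjection (M (V.starProjection z.fst))
      - V.starProjection (M (V.starProjection w.fst))⟫_ℝ
    rw [← map_sub, ← V.inner_starProjection_left_eq_right, map_sub]
    exact hM _ _
  -- The coupling is skew: the adjoint terms cancel, so it contributes exactly zero.
  · rw [inner_productSpace]
    change 0 = ⟪z.fst - w.fst, V.starProjection (∑ i, (L i).adjoint (z.snd i))
      - V.starProjection (∑ i, (L i).adjoint (w.snd i))⟫_ℝ
      + ∑ i, ⟪z.snd i - w.snd i, -L i (V.starProjection z.fst) - -L i (V.starProjection w.fst)⟫_ℝ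
    rw [← map_sub, ← V.inner_starProjection_left_eq_right, ← Finset.sum_sub_distrib, inner_sum,
      ← Finset.sum_add_distrib]
    refine (Finset.sum_eq_zero fun i _ => ?_).symm
    rw [← map_sub, ContinuousLinearMap.adjoint_inner_right, neg_sub_neg, ← map_sub, ← map_sub,
      ← neg_sub z.fst w.fst, map_neg, map_neg, inner_neg_right, real_inner_comm, add_neg_cancel]

theorem lipschitzWith_lipschitzPart {M : H → H} {N : ∀ i, G i → G i} {k : ℝ≥0}
    (hM : LipschitzWith k M) (hN : ∀ i, LipschitzWith k (N i)) (L : ∀ i, H →L[ℝ] G i)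
    {γ : ℝ} (hγ : 0 ≤ γ) :
    LipschitzWith (Real.toNNReal (γ * (k + √(∑ i, ‖L i‖ ^ 2)))) (lipschitzPart V M N L γ) := by
  refine LipschitzWith.of_dist_le_mul fun z w => ?_
  rw [Real.coe_toNNReal _ (by positivity), dist_eq_norm, dist_eq_norm, lipschitzPart,
    lipschitzPart, ← smul_sub, norm_smul, Real.norm_of_nonneg hγ, mul_assoc]
  refine mul_le_mul_of_nonneg_left ?_ hγ
  rw [add_sub_add_comm, add_mul]
  have hz := norm_sq_productSpace (z - w)
  change ‖z - w‖ ^ 2 = ‖z.fst - w.fst‖ ^ 2 + ∑ i, ‖z.snd i - w.snd i‖ ^ 2 at hz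
  refine (norm_add_le _ _).trans (add_le_add ?_ ?_)
  · refine le_of_sq_le_sq ?_ (by positivity)
    rw [norm_sq_productSpace]
    change ‖V.starProjection (M (V.starProjection z.fst))
      - V.starProjection (M (V.starProjection w.fst))‖ ^ 2
      + ∑ i, ‖N i (z.snd i) - N i (w.snd i)‖ ^ 2 ≤ _
    rw [mul_pow, hz, mul_add, Finset.mul_sum]
    refine add_le_add ?_ (Finset.sum_le_sum fun i _ => ?_)
    · rw [← mul_pow, ← map_sub]
      gcongr
      refine (V.norm_starProjection_apply_le _).trans ((hM.norm_sub_le _ _).trans ?_)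
      rw [← map_sub]
      gcongr
      exact V.norm_starProjection_apply_le _
    · rw [← mul_pow]
      gcongr
      exact (hN i).norm_sub_le _ _
  -- The skew coupling has norm at most `√(∑ ‖L i‖²)`: operator norms bound the dual components, and
  -- Cauchy–Schwarz over `i` bounds the primal one.
  · refine le_of_sq_le_sq ?_ (by positivity)
    rw [norm_sq_productSpace]
    change ‖V.starProjection (∑ i, (L i).adjoint (z.snd i))
      - V.starProjection (∑ i, (L i).adjoint (w.snd i))‖ ^ 2
      + ∑ i, ‖-L i (V.starProjection z.fst) - -L i (V.starProjection w.fst)‖ ^ 2 ≤ _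
    rw [mul_pow, Real.sq_sqrt (by positivity), hz, mul_add, add_comm]
    refine add_le_add ?_ ?_
    · rw [Finset.sum_mul]
      refine Finset.sum_le_sum fun i _ => ?_
      rw [← mul_pow, neg_sub_neg, ← map_sub, ← map_sub, norm_sub_rev z.fst]
      gcongr
      exact ((L i).le_opNorm _).trans (by gcongr; exact V.norm_starProjection_apply_le _)
    · rw [← map_sub, ← Finset.sum_sub_distrib]
      have h1 : ‖V.starProjection (∑ i, ((L i).adjoint (z.snd i) - (L i).adjoint (w.snd i)))‖
          ≤ ∑ i, ‖L i‖ * ‖z.snd i - w.snd i‖ := by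
        refine (V.norm_starProjection_apply_le _).trans (norm_sum_le_of_le _ fun i _ => ?_)
        rw [← map_sub, ← ContinuousLinearMap.adjoint.norm_map (L i)]
        exact ((L i).adjoint).le_opNorm _
      exact (pow_le_pow_left₀ (norm_nonneg _) h1 2).trans (Finset.sum_mul_sq_le_sq_mul_sq _ _ _)

theorem lipschitzPart_add_cocoercivePart_fst (M C : H → H) (N D : ∀ i, G i → G i)
    (L : ∀ i, H →L[ℝ] G i) (γ : ℝ) (z : ProductSpace H G) :
    (lipschitzPart V M N L γ z + cocoercivePart V C D γ z).fst
      = γ • V.starProjection (M (V.starProjection z.fst) + C (V.starProjection z.fst)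
        + ∑ i, (L i).adjoint (z.snd i)) := by
  change γ • (V.starProjection _ + V.starProjection _) + γ • V.starProjection _ = _
  rw [map_add, map_add, smul_add, smul_add, smul_add]
  abel

theorem lipschitzPart_add_cocoercivePart_snd (M C : H → H) (N D : ∀ i, G i → G i)
    (L : ∀ i, H →L[ℝ] G i) (γ : ℝ) (z : ProductSpace H G) (i : Fin m) :
    (lipschitzPart V M N L γ z + cocoercivePart V C D γ z).snd i
      = γ • (N i (z.snd i) + D i (z.snd i) - L i (V.starProjection z.fst)) := by
  change γ • (N i (z.snd i) + -L i (V.starProjection z.fst)) + γ • D i (z.snd i) = _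
  rw [← smul_add]
  congr 1
  abel

end ProductSpace

end PrimalDual

/-! ### Solutions as zeros, and the routine as an iteration on the product space. -/

namespace PrimalDual

open SetValued

section Algorithm

variable {H : Type*} [NormedAddCommGroup H] [InnerProductSpace ℝ H] [CompleteSpace H]
  {m : ℕ} {G : Fin m → Type*} [∀ i, NormedAddCommGroup (G i)]
  [∀ i, InnerProductSpace ℝ (G i)] [∀ i, CompleteSpace (G i)]
  {V : ClosedSubmodule ℝ H} {A : H → Set H} {M C : H → H} {B N D : ∀ i, G i → Set (G i)}
  {L : ∀ i, H →L[ℝ] G i} {γ : ℝ} {N' D' : ∀ i, G i → G i}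

theorem mem_solutionSet_iff (hN : ∀ i u, inv (N i) u = {N' i u})
    (hD : ∀ i u, inv (D i) u = {D' i u}) {x : H} {u : ∀ i, G i} :
    (x, u) ∈ solutionSet V A M C B N D L ↔
      (x ∈ V.toSubmodule ∧ ∃ a ∈ A x,
        a + (M x + C x + ∑ i, (L i).adjoint (u i)) ∈ V.toSubmoduleᗮ) ∧
      ∀ i, L i x - (N' i (u i) + D' i (u i)) ∈ inv (B i) (u i) := by
  refine and_congr ?_ (forall_congr' fun i => ?_)
  · simp only [Set.mem_add, Set.mem_singleton_iff]
    constructor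
    · rintro ⟨_, ⟨_, ⟨_, ⟨a, ha, _, rfl, rfl⟩, _, rfl, rfl⟩, _, rfl, rfl⟩, v, hv, h⟩
      obtain ⟨hx, hv⟩ := mem_normalCone_submodule (V := V.toSubmodule).1 hv
      refine ⟨hx, a, ha, ?_⟩
      rw [show a + (M x + C x + ∑ i, (L i).adjoint (u i)) = -v by
        rw [eq_neg_iff_add_eq_zero, ← h]; abel]
      exact neg_mem hv
    · rintro ⟨hx, a, ha, h⟩
      exact ⟨_, ⟨_, ⟨_, ⟨a, ha, _, rfl, rfl⟩, _, rfl, rfl⟩, _, rfl, rfl⟩, _,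
        mem_normalCone_submodule (V := V.toSubmodule).2 ⟨hx, neg_mem h⟩, by abel⟩
  · rw [hN, hD]
    simp only [Set.mem_sub, Set.mem_add, Set.mem_singleton_iff]
    constructor
    · rintro ⟨_, ⟨_, ⟨b, hb, _, rfl, rfl⟩, _, rfl, rfl⟩, _, rfl, h⟩
      rwa [show L i x - (N' i (u i) + D' i (u i)) = b by
        rw [sub_eq_zero] at h; rw [← h]; abel]
    · intro h
      exact ⟨_, ⟨_, ⟨_, h, _, rfl, rfl⟩, _, rfl, rfl⟩, _, rfl, by abel⟩

/-- The maximally monotone part of the primal-dual inclusion in the product space. -/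
noncomputable def resolventPart (V : ClosedSubmodule ℝ H) (A : H → Set H)
    (B : ∀ i, G i → Set (G i)) (γ : ℝ) : ProductSpace H G → Set (ProductSpace H G) :=
  productOperator (partialInverse (γ • A) V.toSubmodule) fun i => γ • inv (B i)

theorem isMaximallyMonotone_resolventPart {H : Type*} [NormedAddCommGroup H]
    [InnerProductSpace ℝ H] [CompleteSpace H] {m : ℕ} {G : Fin m → Type*}
    [∀ i, NormedAddCommGroup (G i)] [∀ i, InnerProductSpace ℝ (G i)] {V : ClosedSubmodule ℝ H}
    {A : H → Set H} {B : ∀ i, G i → Set (G i)} {γ : ℝ} (hA : IsMaximallyMonotone A)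
    (hB : ∀ i, IsMaximallyMonotone (B i)) (hγ : 0 < γ) :
    IsMaximallyMonotone (resolventPart V A B γ) :=
  isMaximallyMonotone_productOperator ((hA.smul hγ).partialInverse _)
    fun i => (hB i).inv.smul hγ

/-- The forward terms have first component in `V`, so undoing the exchange evaluates `A` at the
`V`-part of `z.fst`, and `γ⁻¹` times its `Vᗮ`-part becomes the `Vᗮ`-part of the selected value of
`A`. -/
theorem neg_mem_resolventPart_iff (hγ : 0 < γ) {z : ProductSpace H G} :
    -(lipschitzPart V.toSubmodule M N' L γ z + cocoercivePart V.toSubmodule C D' γ z)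
      ∈ resolventPart V A B γ z ↔
    (-V.toSubmodule.starProjection (M (V.toSubmodule.starProjection z.fst)
        + C (V.toSubmodule.starProjection z.fst) + ∑ i, (L i).adjoint (z.snd i))
      + γ⁻¹ • V.toSubmoduleᗮ.starProjection z.fst ∈ A (V.toSubmodule.starProjection z.fst)) ∧
      ∀ i, L i (V.toSubmodule.starProjection z.fst) - (N' i (z.snd i) + D' i (z.snd i))
        ∈ inv (B i) (z.snd i) := by
  refine and_congr ?_ (forall_congr' fun i => ?_)
  · rw [WithLp.neg_fst, lipschitzPart_add_cocoercivePart_fst, partialInverse, Set.mem_ofPred_eq,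
      ← smul_neg, ← map_neg, map_smul, map_smul, V.toSubmodule.starProjection_eq_self_iff.2
        (V.toSubmodule.starProjection_apply_mem _),
      V.toSubmoduleᗮ.starProjection_apply_eq_zero_iff.2
        (V.toSubmodule.le_orthogonal_orthogonal (V.toSubmodule.starProjection_apply_mem _)),
      smul_zero, add_zero, Pi.smul_apply, Set.mem_smul_set_iff_inv_smul_mem₀ hγ.ne', smul_add,
      inv_smul_smul₀ hγ.ne', map_neg]
  · rw [WithLp.neg_snd, PiLp.neg_apply, lipschitzPart_add_cocoercivePart_snd, ← smul_neg, neg_sub]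
    exact Set.smul_mem_smul_set_iff₀ hγ.ne' _ _

theorem mem_solutionSet_of_neg_mem (hN : ∀ i u, inv (N i) u = {N' i u})
    (hD : ∀ i u, inv (D i) u = {D' i u}) (hγ : 0 < γ) {z : ProductSpace H G}
    (hz : -(lipschitzPart V.toSubmodule M N' L γ z + cocoercivePart V.toSubmodule C D' γ z)
      ∈ resolventPart V A B γ z) :
    (V.toSubmodule.starProjection z.fst, fun i => z.snd i) ∈ solutionSet V A M C B N D L := by
  obtain ⟨h1, h2⟩ := (neg_mem_resolventPart_iff hγ).1 hz
  refine (mem_solutionSet_iff hN hD).2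
    ⟨⟨V.toSubmodule.starProjection_apply_mem _, _, h1, ?_⟩, h2⟩
  rw [add_right_comm, neg_add_eq_sub]
  exact add_mem (V.toSubmodule.sub_starProjection_mem_orthogonal _)
    (Submodule.smul_mem _ _ (V.toSubmoduleᗮ.starProjection_apply_mem _))

theorem exists_neg_mem_of_mem_solutionSet (hN : ∀ i u, inv (N i) u = {N' i u})
    (hD : ∀ i u, inv (D i) u = {D' i u}) (hγ : 0 < γ)
    (hZ : (solutionSet V A M C B N D L).Nonempty) :
    ∃ z, -(lipschitzPart V.toSubmodule M N' L γ z + cocoercivePart V.toSubmodule C D' γ z)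
      ∈ resolventPart V A B γ z := by
  obtain ⟨⟨x, u⟩, h⟩ := hZ
  obtain ⟨⟨hx, a, ha, hQ⟩, hu⟩ := (mem_solutionSet_iff hN hD).1 h
  set Q := M x + C x + ∑ i, (L i).adjoint (u i) with hQdef
  set W := V.toSubmodule with hW
  have h1 : W.starProjection (x + γ • Wᗮ.starProjection a) = x := by
    rw [map_add, W.starProjection_eq_self_iff.2 hx, map_smul,
      W.starProjection_apply_eq_zero_iff.2 (Wᗮ.starProjection_apply_mem _), smul_zero, add_zero]
  have h2 : Wᗮ.starProjection (x + γ • Wᗮ.starProjection a) = γ • Wᗮ.starProjection a := by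
    rw [map_add, Wᗮ.starProjection_apply_eq_zero_iff.2 (W.le_orthogonal_orthogonal hx), zero_add,
      Wᗮ.starProjection_eq_self_iff.2 (Submodule.smul_mem _ _ (Wᗮ.starProjection_apply_mem _))]
  -- The normal-cone condition fixes the `V`-part of `a` as minus the projection of `Q`; its free
  -- `Vᗮ`-part is stored, scaled by `γ`, in the first component.
  refine ⟨mkProduct (x + γ • Wᗮ.starProjection a) u, (neg_mem_resolventPart_iff hγ).2 ⟨?_, ?_⟩⟩
  · change -W.starProjection (M (W.starProjection (x + γ • Wᗮ.starProjection a))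
      + C (W.starProjection (x + γ • Wᗮ.starProjection a)) + ∑ i, (L i).adjoint (u i))
      + γ⁻¹ • Wᗮ.starProjection (x + γ • Wᗮ.starProjection a)
      ∈ A (W.starProjection (x + γ • Wᗮ.starProjection a))
    rw [h1, h2, inv_smul_smul₀ hγ.ne', ← hQdef]
    have h3 := W.starProjection_apply_eq_zero_iff.2 hQ
    rw [map_add, add_comm, ← eq_neg_iff_add_eq_zero] at h3
    rwa [h3, neg_neg, W.starProjection_add_starProjection_orthogonal]
  · intro i
    change L i (W.starProjection (x + γ • Wᗮ.starProjection a)) - (N' i (u i) + D' i (u i))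
      ∈ inv (B i) (u i)
    rw [h1]
    exact hu i

variable {x₀ y₀ : H} {u₀ : ∀ i, G i} {s : Iterates H G}

theorem IsRun.x_mem_and_y_mem (hs : IsRun V A M C B N D L γ x₀ y₀ u₀ s) (hx₀ : x₀ ∈ V)
    (hy₀ : y₀ ∈ V.toSubmoduleᗮ) (n : ℕ) : s.x n ∈ V.toSubmodule ∧ s.y n ∈ V.toSubmoduleᗮ := by
  induction n with
  | zero => exact ⟨hs.x_zero ▸ hx₀, hs.y_zero ▸ hy₀⟩
  | succ n ih =>
    rw [hs.x_succ, hs.y_succ, hs.q_eq]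
    exact ⟨sub_mem (V.toSubmodule.starProjection_apply_mem _)
        (Submodule.smul_mem _ _ (V.toSubmodule.starProjection_apply_mem _)),
      sub_mem ih.2 (Submodule.smul_mem _ _
        (V.toSubmodule.sub_starProjection_mem_orthogonal _))⟩

/-- The backward step of the product iteration has output `(q n + γ y (n + 1), r n)`. Exchanging
`Vᗮ`-components turns `q n + γ y (n + 1)` into `p n`, because `γ (y n - y (n + 1)) = p n - q n`. -/
theorem IsRun.sub_mem_resolventPart (hs : IsRun V A M C B N D L γ x₀ y₀ u₀ s)
    (hN : ∀ i u, inv (N i) u = {N' i u}) (hD : ∀ i u, inv (D i) u = {D' i u}) (hγ : 0 < γ)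
    (hx₀ : x₀ ∈ V) (hy₀ : y₀ ∈ V.toSubmoduleᗮ) (n : ℕ) :
    mkProduct (s.x n + γ • s.y n) (s.u n)
      - (lipschitzPart V.toSubmodule M N' L γ (mkProduct (s.x n + γ • s.y n) (s.u n))
        + cocoercivePart V.toSubmodule C D' γ (mkProduct (s.x n + γ • s.y n) (s.u n)))
      - mkProduct (s.q n + γ • s.y (n + 1)) (s.r n)
      ∈ resolventPart V A B γ (mkProduct (s.q n + γ • s.y (n + 1)) (s.r n)) := by
  obtain ⟨hx, hy⟩ := hs.x_mem_and_y_mem hx₀ hy₀ n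
  obtain ⟨-, hy'⟩ := hs.x_mem_and_y_mem hx₀ hy₀ (n + 1)
  have hp := mem_setResolvent.1 (hs.p_mem n)
  set W := V.toSubmodule with hW
  have hq : s.q n ∈ W := hs.q_eq n ▸ W.starProjection_apply_mem _
  have hproj : ∀ a ∈ W, ∀ b ∈ Wᗮ, W.starProjection (a + b) = a ∧ Wᗮ.starProjection (a + b) = b := by
    intro a ha b hb
    rw [map_add, map_add, W.starProjection_eq_self_iff.2 ha, Wᗮ.starProjection_eq_self_iff.2 hb,
      W.starProjection_apply_eq_zero_iff.2 hb,
      Wᗮ.starProjection_apply_eq_zero_iff.2 (W.le_orthogonal_orthogonal ha)]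
    simp
  have hPz : W.starProjection (mkProduct (s.x n + γ • s.y n) (s.u n)).fst = s.x n :=
    (hproj _ hx _ (Submodule.smul_mem _ _ hy)).1
  refine ⟨?_, fun i => ?_⟩
  · rw [WithLp.sub_fst, WithLp.sub_fst, lipschitzPart_add_cocoercivePart_fst, hPz]
    change s.x n + γ • s.y n - γ • W.starProjection (M (s.x n) + C (s.x n)
      + ∑ i, (L i).adjoint (s.u n i)) - (s.q n + γ • s.y (n + 1))
      ∈ partialInverse (γ • A) W (s.q n + γ • s.y (n + 1))
    set Q := W.starProjection (M (s.x n) + C (s.x n) + ∑ i, (L i).adjoint (s.u n i))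
    have e1 := hproj _ hq _ (Submodule.smul_mem _ γ hy')
    have e2 := hproj (s.x n - γ • Q - s.q n)
      (sub_mem (sub_mem hx (Submodule.smul_mem _ _ (W.starProjection_apply_mem _))) hq)
      (γ • s.y n - γ • s.y (n + 1))
      (sub_mem (Submodule.smul_mem _ _ hy) (Submodule.smul_mem _ _ hy'))
    have hys : γ • s.y (n + 1) = γ • s.y n - (s.p n - s.q n) := by
      rw [hs.y_succ, smul_sub, smul_inv_smul₀ hγ.ne']
    rw [show s.x n + γ • s.y n - γ • Q - (s.q n + γ • s.y (n + 1))
      = (s.x n - γ • Q - s.q n) + (γ • s.y n - γ • s.y (n + 1)) by abel, partialInverse,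
      Set.mem_ofPred_eq, e1.1, e1.2, e2.1, e2.2, hys]
    rwa [show s.q n + (γ • s.y n - (γ • s.y n - (s.p n - s.q n))) = s.p n by abel,
      show s.x n - γ • Q - s.q n + (γ • s.y n - (s.p n - s.q n))
        = s.x n + γ • s.y n - γ • Q - s.p n by abel]
  · rw [WithLp.sub_snd, WithLp.sub_snd, PiLp.sub_apply, PiLp.sub_apply,
      lipschitzPart_add_cocoercivePart_snd, hPz]
    obtain ⟨w, hw, hr⟩ := hs.r_mem n i
    rw [hN, hD, Set.singleton_add_singleton, Set.mem_singleton_iff] at hw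
    subst hw
    exact mem_setResolvent.1 hr

/-- The half-forward correction has first component in `V`, so `γ y (n + 1)`, already updated by the
backward step, is left unchanged. -/
theorem IsRun.mkProduct_succ (hs : IsRun V A M C B N D L γ x₀ y₀ u₀ s)
    (hN : ∀ i u, inv (N i) u = {N' i u}) (hx₀ : x₀ ∈ V) (hy₀ : y₀ ∈ V.toSubmoduleᗮ) (n : ℕ) :
    mkProduct (s.x (n + 1) + γ • s.y (n + 1)) (s.u (n + 1))
      = mkProduct (s.q n + γ • s.y (n + 1)) (s.r n)
        - (lipschitzPart V.toSubmodule M N' L γ (mkProduct (s.q n + γ • s.y (n + 1)) (s.r n))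
          - lipschitzPart V.toSubmodule M N' L γ (mkProduct (s.x n + γ • s.y n) (s.u n))) := by
  obtain ⟨hx, hy⟩ := hs.x_mem_and_y_mem hx₀ hy₀ n
  obtain ⟨-, hy'⟩ := hs.x_mem_and_y_mem hx₀ hy₀ (n + 1)
  set W := V.toSubmodule with hW
  have hq : s.q n ∈ W := hs.q_eq n ▸ W.starProjection_apply_mem _
  have hproj : ∀ a ∈ W, ∀ b ∈ Wᗮ, W.starProjection (a + γ • b) = a := by
    intro a ha b hb
    rw [map_add, W.starProjection_eq_self_iff.2 ha,
      W.starProjection_apply_eq_zero_iff.2 (Submodule.smul_mem _ _ hb), add_zero]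
  refine (WithLp.ofLp_injective 2) (Prod.ext ?_ ((WithLp.ofLp_injective 2) (funext fun i => ?_)))
  · change s.x (n + 1) + γ • s.y (n + 1) = s.q n + γ • s.y (n + 1)
      - (γ • (W.starProjection (M (W.starProjection (s.q n + γ • s.y (n + 1))))
          + W.starProjection (∑ i, (L i).adjoint (s.r n i)))
        - γ • (W.starProjection (M (W.starProjection (s.x n + γ • s.y n)))
          + W.starProjection (∑ i, (L i).adjoint (s.u n i))))
    rw [hproj _ hq _ hy', hproj _ hx _ hy, hs.x_succ, ← smul_sub, add_sub_add_comm, ← map_sub,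
      ← map_sub, ← map_add, ← Finset.sum_sub_distrib]
    simp only [map_sub]
    abel
  · change s.u (n + 1) i = s.r n i
      - (γ • (N' i (s.r n i) + -L i (W.starProjection (s.q n + γ • s.y (n + 1))))
        - γ • (N' i (s.u n i) + -L i (W.starProjection (s.x n + γ • s.y n))))
    rw [hproj _ hq _ hy', hproj _ hx _ hy]
    obtain ⟨a, ha, b, hb, hu⟩ := hs.u_succ n i
    rw [hN, Set.mem_singleton_iff] at ha hb
    subst ha hb
    rw [hu, ← smul_sub, map_sub]
    congr 2
    abel

/-- The routine generates exactly one family of sequences. -/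
theorem existsUnique_isRun (hA : IsMaximallyMonotone A) (hB : ∀ i, IsMaximallyMonotone (B i))
    (hN : ∀ i u, inv (N i) u = {N' i u}) (hD : ∀ i u, inv (D i) u = {D' i u}) (hγ : 0 < γ)
    (M C : H → H) (L : ∀ i, H →L[ℝ] G i) (x₀ y₀ : H) (u₀ : ∀ i, G i) :
    ∃! s : Iterates H G, IsRun V A M C B N D L γ x₀ y₀ u₀ s := by
  have hγA := hA.smul hγ
  have hγB := fun i => (hB i).inv.smul hγ
  choose J hJ using hγA.exists_sub_mem
  choose J' hJ' using fun i => (hγB i).exists_sub_mem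
  have hJu : ∀ w p, p ∈ setResolvent (γ • A) w ↔ p = J w := fun w p => by
    rw [mem_setResolvent]
    exact ⟨fun h => hγA.isMonotone.eq_of_sub_mem h (hJ w), fun h => h ▸ hJ w⟩
  have hJu' : ∀ i w p, p ∈ setResolvent (γ • inv (B i)) w ↔ p = J' i w := fun i w p => by
    rw [mem_setResolvent]
    exact ⟨fun h => (hγB i).isMonotone.eq_of_sub_mem h (hJ' i w), fun h => h ▸ hJ' i w⟩
  let W := V.toSubmodule
  let p : H × H × (∀ i, G i) → H := fun z => J (z.1 + γ • z.2.1
    - γ • W.starProjection (M z.1 + C z.1 + ∑ i, (L i).adjoint (z.2.2 i)))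
  let q : H × H × (∀ i, G i) → H := fun z => W.starProjection (p z)
  let r : H × H × (∀ i, G i) → ∀ i, G i := fun z i =>
    J' i (z.2.2 i - γ • (N' i (z.2.2 i) + D' i (z.2.2 i) - L i z.1))
  let step : H × H × (∀ i, G i) → H × H × (∀ i, G i) := fun z =>
    (q z - γ • W.starProjection (M (q z) - M z.1 + ∑ i, (L i).adjoint (r z i - z.2.2 i)),
      z.2.1 - γ⁻¹ • (p z - q z),
      fun i => r z i - γ • (N' i (r z i) - N' i (z.2.2 i) - L i (q z - z.1)))
  let z : ℕ → H × H × (∀ i, G i) := fun n => step^[n] (x₀, y₀, u₀)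
  have hz : ∀ n, z (n + 1) = step (z n) := fun n => Function.iterate_succ_apply' _ _ _
  refine ⟨⟨fun n => (z n).1, fun n => (z n).2.1, fun n => p (z n), fun n => q (z n),
    fun n => r (z n), fun n => (z n).2.2⟩, ⟨rfl, rfl, rfl, fun n => (hJu _ _).2 rfl,
    fun n => rfl, fun n i => ?_, fun n i => ?_, fun n => ?_, fun n => ?_⟩, fun s hs => ?_⟩
  · refine ⟨N' i ((z n).2.2 i) + D' i ((z n).2.2 i), ?_, (hJu' _ _ _).2 rfl⟩
    rw [hN, hD, Set.singleton_add_singleton, Set.mem_singleton_iff]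
  · refine ⟨N' i (r (z n) i), ?_, N' i ((z n).2.2 i), ?_, ?_⟩
    · rw [hN, Set.mem_singleton_iff]
    · rw [hN, Set.mem_singleton_iff]
    · simp only [hz]; rfl
  · simp only [hz]; rfl
  · simp only [hz]; rfl
  · have hp : ∀ n, s.p n = p (s.x n, s.y n, s.u n) := fun n => (hJu _ _).1 (hs.p_mem n)
    have hq : ∀ n, s.q n = q (s.x n, s.y n, s.u n) := fun n => by rw [hs.q_eq, hp]
    have hr : ∀ n, s.r n = r (s.x n, s.y n, s.u n) := fun n => funext fun i => by
      obtain ⟨w, hw, hr⟩ := hs.r_mem n i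
      rw [hN, hD, Set.singleton_add_singleton, Set.mem_singleton_iff] at hw
      subst hw
      exact (hJu' _ _ _).1 hr
    have hstate : ∀ n, (s.x n, s.y n, s.u n) = z n := by
      intro n
      induction n with
      | zero => rw [hs.x_zero, hs.y_zero, hs.u_zero]; rfl
      | succ n ih =>
        rw [hz, ← ih]
        refine Prod.ext ?_ (Prod.ext ?_ (funext fun i => ?_))
        · exact (hs.x_succ n).trans (by rw [hq, hr])
        · exact (hs.y_succ n).trans (by rw [hq, hp])
        · obtain ⟨a, ha, b, hb, hu⟩ := hs.u_succ n i
          rw [hN, Set.mem_singleton_iff] at ha hb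
          subst ha hb
          exact hu.trans (by rw [hq, hr])
    obtain ⟨sx, sy, sp, sq, sr, su⟩ := s
    simp only at hp hq hr hstate
    simp only [Iterates.mk.injEq]
    simp only [hstate] at hp hq hr
    exact ⟨funext fun n => congrArg Prod.fst (hstate n),
      funext fun n => congrArg (fun z => z.2.1) (hstate n), funext hp, funext hq, funext hr,
      funext fun n => congrArg (fun z => z.2.2) (hstate n)⟩

/-- For `ℓ ≠ 0`, `chi β ℓ` is the rationalized positive root of `ℓ² γ² + γ / (2 β) = 1`. Isolating
the square root and squaring also covers `ℓ = 0`. -/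
theorem sq_add_lt_one_of_lt_chi {β ℓ γ : ℝ} (hβ : 0 < β) (hγ : 0 < γ) (h : γ < chi β ℓ) :
    (γ * ℓ) ^ 2 + 1 / (2 * (β / γ)) < 1 := by
  set t := √(1 + 16 * β ^ 2 * ℓ ^ 2) with ht
  have ht2 : t ^ 2 = 1 + 16 * β ^ 2 * ℓ ^ 2 := Real.sq_sqrt (by positivity)
  have ht0 : 0 ≤ t := Real.sqrt_nonneg _
  rw [chi, lt_div_iff₀ (by positivity)] at h
  have h1 : γ * t < 4 * β - γ := by linarith
  have h2 : (γ * t) ^ 2 < (4 * β - γ) ^ 2 := pow_lt_pow_left₀ h1 (by positivity) two_ne_zero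
  rw [mul_pow, ht2] at h2
  have h3 : 1 / (2 * (β / γ)) = γ / (2 * β) := by field_simp
  rw [h3, ← sub_pos]
  have h4 : 1 - ((γ * ℓ) ^ 2 + γ / (2 * β))
      = ((4 * β - γ) ^ 2 - γ ^ 2 * (1 + 16 * β ^ 2 * ℓ ^ 2)) / (16 * β ^ 2) := by
    field_simp
    ring
  rw [h4]
  exact div_pos (by linarith) (by positivity)

end Algorithm

end PrimalDual

/-! ### Assembly of the convergence theorem. -/

theorem proposition4p2
    {H : Type*} [NormedAddCommGroup H] [InnerProductSpace ℝ H] [CompleteSpace H]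
    {m : ℕ} (hm : 0 < m)
    {G : Fin m → Type*} [∀ i, NormedAddCommGroup (G i)]
    [∀ i, InnerProductSpace ℝ (G i)] [∀ i, CompleteSpace (G i)]
    (V : ClosedSubmodule ℝ H)
    (A : H → Set H) (hA : SetValued.IsMaximallyMonotone A)
    (M : H → H) (hM : ∀ x y, 0 ≤ ⟪x - y, M x - M y⟫_ℝ)
    (μ : ℝ≥0) (hμ : 0 < μ) (hMμ : LipschitzWith μ M)
    (C : H → H) (ζ : ℝ) (hζ : 0 < ζ) (hC : SetValued.IsCocoercive ζ C)
    (B : ∀ i, G i → Set (G i)) (hB : ∀ i, SetValued.IsMaximallyMonotone (B i))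
    (N : ∀ i, G i → Set (G i)) (hN : ∀ i, SetValued.IsMonotone (N i))
    (ν : Fin m → ℝ≥0) (hν : ∀ i, 0 < ν i)
    (hNν : ∀ i, SetValued.IsLipschitzian (ν i) (SetValued.inv (N i)))
    (D : ∀ i, G i → Set (G i)) (hD : ∀ i, SetValued.IsMaximallyMonotone (D i))
    (δ : Fin m → ℝ) (hδ : ∀ i, 0 < δ i)
    (hDδ : ∀ i, SetValued.IsStronglyMonotone (δ i) (D i))
    (L : ∀ i, H →L[ℝ] G i) (hL : ∀ i, L i ≠ 0)
    (hZ : (PrimalDual.solutionSet V A M C B N D L).Nonempty)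
    (ℓ β : ℝ)
    (hℓ : ℓ = max (μ : ℝ) (⨆ i, (ν i : ℝ)) + √(∑ i, ‖L i‖ ^ 2))
    (hβ : β = min ζ (⨅ i, δ i))
    (γ : ℝ) (hγ : γ ∈ Set.Ioo 0 (PrimalDual.chi β ℓ))
    (x₀ : H) (hx₀ : x₀ ∈ V) (y₀ : H) (hy₀ : y₀ ∈ V.toSubmoduleᗮ) (u₀ : ∀ i, G i) :
    (∃! s : PrimalDual.Iterates H G, PrimalDual.IsRun V A M C B N D L γ x₀ y₀ u₀ s) ∧
    ∀ s : PrimalDual.Iterates H G, PrimalDual.IsRun V A M C B N D L γ x₀ y₀ u₀ s →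
      (∀ n, s.x n ∈ V) ∧
      ∃ z ∈ PrimalDual.solutionSet V A M C B N D L,
        WeaklyConverges s.x z.1 ∧ ∀ i, WeaklyConverges (fun n => s.u n i) (z.2 i) := by
  have hγ0 : 0 < γ := hγ.1
  choose N' hN' hN'ν using hNν
  choose D' hD' hD'δ using fun i => (hD i).exists_inv_eq_singleton (hδ i) (hDδ i)
  -- Without an index the infimum of `δ` would take the default value `0`, and so would `β`.
  have : Nonempty (Fin m) := ⟨⟨0, hm⟩⟩
  have hβ0 : 0 < β := by
    obtain ⟨i, hi⟩ := exists_eq_ciInf_of_finite (f := δ)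
    rw [hβ, ← hi]
    exact lt_min hζ (hδ i)
  have hβζ : β ≤ ζ := hβ ▸ min_le_left _ _
  have hβδ : ∀ i, β ≤ δ i := fun i =>
    hβ ▸ (min_le_right _ _).trans (ciInf_le (Set.finite_range δ).bddBelow i)
  set k : ℝ≥0 := max μ (⨆ i, ν i) with hk
  have hkμ : μ ≤ k := le_max_left _ _
  have hkν : ∀ i, ν i ≤ k := fun i =>
    (le_ciSup (Set.finite_range ν).bddAbove i).trans (le_max_right _ _)
  have hℓk : ℓ = k + √(∑ i, ‖L i‖ ^ 2) := by
    rw [hℓ, hk, NNReal.coe_max, NNReal.coe_iSup]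
  have hNmono : ∀ i x y, 0 ≤ ⟪x - y, N' i x - N' i y⟫_ℝ := fun i x y => by
    have hmem : ∀ u, u ∈ N i (N' i u) := fun u =>
      (Set.ext_iff.1 (hN' i u) (N' i u)).2 rfl
    rw [real_inner_comm]
    exact hN i _ _ (hmem x) _ _ (hmem y)
  refine ⟨PrimalDual.existsUnique_isRun hA hB hN' hD' hγ0 M C L x₀ y₀ u₀, fun s hs => ?_⟩
  have hmem := hs.x_mem_and_y_mem hx₀ hy₀
  refine ⟨fun n => (hmem n).1, ?_⟩
  have hlip := PrimalDual.lipschitzWith_lipschitzPart V.toSubmodule (hMμ.weaken hkμ)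
    (fun i => (hN'ν i).weaken (hkν i)) L hγ0.le
  rw [← hℓk] at hlip
  obtain ⟨z, hz, hlim⟩ := SetValued.exists_tendsto_inner_of_forwardBackwardHalfForward
    (PrimalDual.isMaximallyMonotone_resolventPart (V := V) hA hB hγ0)
    (PrimalDual.lipschitzPart_monotone V.toSubmodule hM hNmono L hγ0.le) hlip
    (div_pos hβ0 hγ0)
    (PrimalDual.isCocoercive_cocoercivePart V.toSubmodule hβ0.le
      (fun x y => (mul_le_mul_of_nonneg_right hβζ (sq_nonneg _)).trans (hC x y))
      (fun i x y => (mul_le_mul_of_nonneg_right (hβδ i) (sq_nonneg _)).trans (hD'δ i x y)) hγ0)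
    (by
      rw [Real.coe_toNNReal _ (by rw [hℓk]; positivity)]
      exact PrimalDual.sq_add_lt_one_of_lt_chi hβ0 hγ0 hγ.2)
    (PrimalDual.exists_neg_mem_of_mem_solutionSet hN' hD' hγ0 hZ)
    (hs.sub_mem_resolventPart hN' hD' hγ0 hx₀ hy₀) (hs.mkProduct_succ hN' hx₀ hy₀)
  refine ⟨_, PrimalDual.mem_solutionSet_of_neg_mem hN' hD' hγ0 hz,
    weaklyConverges_of_forall_inner fun y => ?_, fun i => weaklyConverges_of_forall_inner fun y => ?_⟩
  -- Testing against a vector of `V` removes `γ y n` and moves the projector onto the limit.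
  · have h := hlim (PrimalDual.mkProduct (V.toSubmodule.starProjection y) 0)
    simp only [PrimalDual.inner_productSpace, WithLp.toLp_fst, WithLp.toLp_snd, PiLp.toLp_apply,
      Pi.zero_apply, inner_zero_right, Finset.sum_const_zero, add_zero] at h
    simp only [← V.toSubmodule.inner_starProjection_left_eq_right] at h
    refine h.congr fun n => ?_
    rw [map_add, V.toSubmodule.starProjection_eq_self_iff.2 (hmem n).1,
      V.toSubmodule.starProjection_apply_eq_zero_iff.2 (Submodule.smul_mem _ _ (hmem n).2),
      add_zero]
  · have h := hlim (PrimalDual.mkProduct 0 (Pi.single i y))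
    have hsum : ∀ w : ∀ j, G j, ∑ j, ⟪w j, (Pi.single i y : ∀ j, G j) j⟫_ℝ = ⟪w i, y⟫_ℝ := by
      intro w
      rw [Finset.sum_eq_single i (fun j _ hj => by rw [Pi.single_eq_of_ne hj, inner_zero_right])
        (fun h => (h (Finset.mem_univ i)).elim), Pi.single_eq_same]
    simp only [PrimalDual.inner_productSpace, WithLp.toLp_fst, WithLp.toLp_snd, PiLp.toLp_apply,
      inner_zero_right, zero_add, hsum] at h
    exact h
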